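/- Let $n\ge 3$, let $m>1$ and $\lambda$ be real numbers, and let $(M^n,g)$ be a connected smooth Riemannian manifold, possibly with boundary (no completeness or compactness is assumed). Suppose that $(M,g,u,\lambda)$ is an $m$-quasi-Einstein manifold, that is, $u:M\to\mathbb{R}$ is a smooth function with $$\nabla^2 u=\frac{u}{m}\,(\mathrm{Ric}-\lambda g)\ \text{ in } M,\qquad u>0\ \text{ in } \mathrm{int}(M),\qquad u=0\ \text{ on } \partial M .$$ Suppose that it is nontrivial, i.e. $u$ is not constant, and that the scalar curvature of $g$ is a constant $R$. Let $T$ be the $3$-tensor given (with summation over repeated indices) by $$\begin{aligned}T_{ijk}={}&\frac{m+n-2}{n-2}\,(R_{ik}\nabla_j u-R_{jk}\nabla_i u)+\frac{m}{n-2}\,(R_{jl}\nabla_l u\,g_{ik}-R_{il}\nabla_l u\,g_{jk})\\&+\frac{(n-1)(n-2)\lambda+mR}{(n-1)(n-2)}\,(\nabla_i u\,g_{jk}-\nabla_j u\,g_{ik})-\frac{u}{2(n-1)}\,(\nabla_i R\,g_{jk}-\nabla_j R\,g_{ik}),\end{aligned}$$ where $R_{ij}$ are the components of the Ricci tensor.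 Then $T$ vanishes identically on $M$ if and only if $$R=\frac{n(n-1)}{m+n-1}\,\lambda\qquad\text{or}\qquad R=(n-1)\lambda .$$ -/

import Mathlib

open scoped Manifold ContDiff
open Bundle Set

noncomputable section

namespace QuasiEinstein

/-! ### Riemannian geometry in coordinates

Here `S` is the coordinate domain (a relatively open subset of the range of a model with corners),
`G y i j` is the matrix `g_ij` of a metric at the point `y ∈ S`, and `f` is a function on `S`. -/

section Coordinates

variable {n : ℕ}

/-- The `i`-th coordinate vector of `ℝⁿ`. -/
def stdVec (i : Fin n) : EuclideanSpace ℝ (Fin n) := EuclideanSpace.single i (1 : ℝ)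

/-- The partial derivative `∂_i f` at `y`, taken within `S` (one-sided at boundary points). -/
def partialDeriv (S : Set (EuclideanSpace ℝ (Fin n))) (f : EuclideanSpace ℝ (Fin n) → ℝ)
    (i : Fin n) (y : EuclideanSpace ℝ (Fin n)) : ℝ :=
  fderivWithin ℝ f S y (stdVec i)

variable (S : Set (EuclideanSpace ℝ (Fin n)))
  (G : EuclideanSpace ℝ (Fin n) → Matrix (Fin n) (Fin n) ℝ)

/-- The Christoffel symbols `Γ^k_ij` of the Levi-Civita connection,
`Γ^k_ij = (1/2) g^{kl} (∂_i g_jl + ∂_j g_il - ∂_l g_ij)`. -/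
def christoffel (k i j : Fin n) (y : EuclideanSpace ℝ (Fin n)) : ℝ :=
  (1 / 2) * ∑ l, (G y)⁻¹ k l *
    (partialDeriv S (fun z => G z j l) i y + partialDeriv S (fun z => G z i l) j y
      - partialDeriv S (fun z => G z i j) l y)

/-- The components of the curvature `R(X, Y) Z = ∇_X ∇_Y Z - ∇_Y ∇_X Z - ∇_[X, Y] Z`:
`R(∂_i, ∂_j) ∂_k = ∑ l, riemann l i j k • ∂_l`. -/
def riemann (l i j k : Fin n) (y : EuclideanSpace ℝ (Fin n)) : ℝ :=
  partialDeriv S (christoffel S G l j k) i y - partialDeriv S (christoffel S G l i k) j y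
    + ∑ p, (christoffel S G p j k y * christoffel S G l i p y
        - christoffel S G p i k y * christoffel S G l j p y)

/-- The Ricci tensor `R_jk = Ric(∂_j, ∂_k)`, the trace of `X ↦ R(X, ∂_j) ∂_k`. -/
def ricci (j k : Fin n) (y : EuclideanSpace ℝ (Fin n)) : ℝ :=
  ∑ i, riemann S G i i j k y

/-- The scalar curvature `R = g^{jk} R_jk`. -/
def scalarCurv (y : EuclideanSpace ℝ (Fin n)) : ℝ :=
  ∑ j, ∑ k, (G y)⁻¹ j k * ricci S G j k y

/-- The Hessian `(∇² f)_ij = ∂_i ∂_j f - Γ^k_ij ∂_k f`. -/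
def hessian (f : EuclideanSpace ℝ (Fin n) → ℝ) (i j : Fin n)
    (y : EuclideanSpace ℝ (Fin n)) : ℝ :=
  partialDeriv S (partialDeriv S f j) i y
    - ∑ k, christoffel S G k i j y * partialDeriv S f k y

/-- The covector `Ric(∇ f)`, with components `R_jl ∇_l f = R_jl g^{lp} ∂_p f`. -/
def ricciGrad (f : EuclideanSpace ℝ (Fin n) → ℝ) (j : Fin n)
    (y : EuclideanSpace ℝ (Fin n)) : ℝ :=
  ∑ l, ∑ p, ricci S G j l y * (G y)⁻¹ l p * partialDeriv S f p y

/-- The components `T_ijk` of the `T`-tensor of a potential function `f`: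
`T_ijk = (m+n-2)/(n-2) (R_ik ∇_j f - R_jk ∇_i f)
  + m/(n-2) (R_jl ∇_l f g_ik - R_il ∇_l f g_jk)
  + ((n-1)(n-2)λ + m R)/((n-1)(n-2)) (∇_i f g_jk - ∇_j f g_ik)
  - f/(2(n-1)) (∇_i R g_jk - ∇_j R g_ik)`. -/
def tensorT (m lam : ℝ) (f : EuclideanSpace ℝ (Fin n) → ℝ) (i j k : Fin n)
    (y : EuclideanSpace ℝ (Fin n)) : ℝ :=
  (m + n - 2) / ((n : ℝ) - 2) *
      (ricci S G i k y * partialDeriv S f j y - ricci S G j k y * partialDeriv S f i y)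
    + m / ((n : ℝ) - 2) *
      (ricciGrad S G f j y * G y i k - ricciGrad S G f i y * G y j k)
    + (((n : ℝ) - 1) * ((n : ℝ) - 2) * lam + m * scalarCurv S G y)
        / (((n : ℝ) - 1) * ((n : ℝ) - 2)) *
      (partialDeriv S f i y * G y j k - partialDeriv S f j y * G y i k)
    - f y / (2 * ((n : ℝ) - 1)) *
      (partialDeriv S (scalarCurv S G) i y * G y j k
        - partialDeriv S (scalarCurv S G) j y * G y i k)

end Coordinates

/-! ### Manifolds, possibly with boundary

`M` is modelled on `ℝⁿ` through the model with corners `I`. A tensor on `M` is described by its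
components in the charts `extChartAt I x₀`, `x₀ : M`, whose domains cover `M`. -/

section Manifolds

variable {n : ℕ} {H : Type*} [TopologicalSpace H]
  {I : ModelWithCorners ℝ (EuclideanSpace ℝ (Fin n)) H}
  {M : Type*} [TopologicalSpace M] [ChartedSpace H M] [IsManifold I ∞ M]

variable (I M) in
/-- Smooth Riemannian metrics on `M`. -/
abbrev SmoothMetric :=
  ContMDiffRiemannianMetric I ∞ (EuclideanSpace ℝ (Fin n)) (fun x : M => TangentSpace I x)

variable (I) in
/-- The coordinate vector field `∂_i` of the chart at `x₀`, at the point with coordinates `y`. -/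
def coordVec (x₀ : M) (i : Fin n) (y : EuclideanSpace ℝ (Fin n)) :
    TangentSpace I ((extChartAt I x₀).symm y) :=
  mfderivWithin 𝓘(ℝ, EuclideanSpace ℝ (Fin n)) I (extChartAt I x₀).symm (range I) y (stdVec i)

/-- The components `g_ij = g(∂_i, ∂_j)` of the metric in the chart at `x₀`. -/
def metricCoord (g : SmoothMetric I M) (x₀ : M) (y : EuclideanSpace ℝ (Fin n)) :
    Matrix (Fin n) (Fin n) ℝ :=
  Matrix.of fun i j => g.inner ((extChartAt I x₀).symm y) (coordVec I x₀ i y) (coordVec I x₀ j y)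

variable (I) in
/-- The function `u` on `M`, expressed in the chart at `x₀`. -/
def funCoord (u : M → ℝ) (x₀ : M) (y : EuclideanSpace ℝ (Fin n)) : ℝ :=
  u ((extChartAt I x₀).symm y)

/-- `(M, g, u, lam)` is an `m`-quasi-Einstein manifold: `u` is smooth (up to the boundary),
`∇² u = (u / m) (Ric - lam g)` on `M`, `u > 0` in the interior and `u = 0` on the boundary. -/
structure IsQuasiEinstein (g : SmoothMetric I M) (u : M → ℝ) (m lam : ℝ) : Prop where
  m_pos : 0 < m
  smooth : ContMDiff I 𝓘(ℝ, ℝ) ∞ u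
  equation : ∀ x₀ : M, ∀ y ∈ (extChartAt I x₀).target, ∀ i j : Fin n,
    hessian (extChartAt I x₀).target (metricCoord g x₀) (funCoord I u x₀) i j y
      = funCoord I u x₀ y / m *
        (ricci (extChartAt I x₀).target (metricCoord g x₀) i j y - lam * metricCoord g x₀ y i j)
  pos_interior : ∀ x ∈ I.interior M, 0 < u x
  zero_boundary : ∀ x ∈ I.boundary M, u x = 0

/-- The scalar curvature of `g` is everywhere equal to `R`. -/
def HasConstantScalarCurv (g : SmoothMetric I M) (R : ℝ) : Prop :=
  ∀ x₀ : M, ∀ y ∈ (extChartAt I x₀).target,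
    scalarCurv (extChartAt I x₀).target (metricCoord g x₀) y = R

/-- The `T`-tensor of `(M, g, u, lam)` vanishes identically. -/
def TFlat (g : SmoothMetric I M) (u : M → ℝ) (m lam : ℝ) : Prop :=
  ∀ x₀ : M, ∀ y ∈ (extChartAt I x₀).target, ∀ i j k : Fin n,
    tensorT (extChartAt I x₀).target (metricCoord g x₀) m lam (funCoord I u x₀) i j k y = 0

end Manifolds

end QuasiEinstein

end

/-! Write ρ = (R - μ)/(n - 1) with μ = ((n - 1)λ - R)/(m - 1). Since R is constant, the contracted
Bianchi identity gives div Ric = 0. Taking the divergence of the quasi-Einstein equation and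
comparing with Bochner's formula gives Ric(∇u) = μ∇u (`ric_gradient`). Computing div(Ric(∇u)) in two
ways then gives u|Ric|² = u(λR + μ(R - nλ)) (`ric_norm_sq`).

With Ric(∇u) = μ∇u, the tensor T becomes a nonzero multiple of the antisymmetrization of (Ric - ρg)
⊗ du (`IsLocalQuasiEinstein.tensorT_eq`). Where du ≠ 0 it vanishes exactly when Ric has the single
eigenvalue ρ on the orthogonal complement of ∇u. The trace and the eigenvalue μ being prescribed,
this is the equality case |Ric|² = μ² + (n - 1)ρ² of Cauchy–Schwarz (`umbilic_iff_trace_sq`). Where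
also u ≠ 0, the value of |Ric|² is known, so the equality is a polynomial condition on R, λ, m, n,
whose two factors give the two values of R (`scalar_dichotomy`).

It remains to globalize. Nonconstancy provides a point in the interior of some chart domain with du
≠ 0, and u ≠ 0 there because a zero of u ≥ 0 would be a local minimum. Conversely T vanishes
trivially at critical points, and by continuity at the boundary points of chart domains.

The curvature identities are proved over an abstract ℝ-algebra with commuting derivations, where
they are polynomial identities between noncommuting matrices. They are then evaluated in the algebra
of smooth functions on a chart domain. -/

set_option linter.unusedSectionVars false

noncomputable section

namespace QuasiEinstein

/-! ### Riemannian geometry over a commutative ring with commuting derivations -/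

section Algebraic

variable {A ι : Type*} [CommRing A] [Algebra ℝ A] [Fintype ι] [DecidableEq ι]

theorem map_derivation_mul (d : Derivation ℝ A A) (M N : Matrix ι ι A) :
    (M * N).map d = M.map d * N + M * N.map d := by
  ext i j
  simp only [Matrix.map_apply, Matrix.mul_apply, Matrix.add_apply, map_sum, Derivation.leibniz,
    smul_eq_mul, ← Finset.sum_add_distrib]
  exact Finset.sum_congr rfl fun k _ => by ring

theorem map_derivation_add (d : Derivation ℝ A A) (M N : Matrix ι ι A) :
    (M + N).map d = M.map d + N.map d := by
  ext i j; simp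

theorem map_derivation_sub (d : Derivation ℝ A A) (M N : Matrix ι ι A) :
    (M - N).map d = M.map d - N.map d := by
  ext i j; simp

theorem map_derivation_one (d : Derivation ℝ A A) : (1 : Matrix ι ι A).map d = 0 := by
  ext i j; by_cases h : i = j <;> simp [h]

variable (D : ι → Derivation ℝ A A) (G H : Matrix ι ι A)

/-- The connection matrices `(Γ_i)^k_j` of the metric `G` with inverse `H`. -/
def connMatrix (i : ι) : Matrix ι ι A :=
  Matrix.of fun k j => (1 / 2 : ℝ) • ∑ l, H k l * (D i (G j l) + D j (G i l) - D l (G i j))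

/-- The curvature matrices `∂_i Γ_j - ∂_j Γ_i + [Γ_i, Γ_j]`. -/
def curvMatrix (i j : ι) : Matrix ι ι A :=
  (connMatrix D G H j).map (D i) - (connMatrix D G H i).map (D j)
    + (connMatrix D G H i * connMatrix D G H j - connMatrix D G H j * connMatrix D G H i)

/-- The Ricci tensor, as a matrix. -/
def ricMatrix : Matrix ι ι A :=
  Matrix.of fun j k => ∑ i, curvMatrix D G H i j i k

/-- The Hessian of `f`, as a matrix. -/
def hessMatrix (f : A) : Matrix ι ι A :=
  Matrix.of fun i j => D i (D j f) - ∑ k, connMatrix D G H i k j * D k f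

/-- The divergence of a tensor `N_i^a`. -/
def divTensor (N : Matrix ι ι A) (i : ι) : A :=
  ∑ a, D a (N i a) + ∑ p, (connMatrix D G H p).trace * N i p
    - ∑ a, ∑ p, connMatrix D G H i a p * N a p

variable {D G H}

theorem connMatrix_comm (hG : G.IsSymm) (i j k : ι) :
    connMatrix D G H i k j = connMatrix D G H j k i := by
  simp only [connMatrix, Matrix.of_apply]
  congr 1
  refine Finset.sum_congr rfl fun l _ => ?_
  rw [hG.apply i j]; ring

theorem trace_connMatrix (hG : G.IsSymm) (i : ι) :
    ∑ a, connMatrix D G H a a i = (connMatrix D G H i).trace := by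
  simp only [Matrix.trace, Matrix.diag_apply]
  exact Finset.sum_congr rfl fun a _ => connMatrix_comm hG _ _ _

theorem mul_connMatrix_apply (hGH : G * H = 1) (i j k : ι) :
    (G * connMatrix D G H i) k j = (1 / 2 : ℝ) • (D i (G j k) + D j (G i k) - D k (G i j)) := by
  have h : ∀ w : ι → A, ∑ p, G k p * ∑ l, H p l * w l = w k := by
    intro w
    have := congrFun (Matrix.mulVec_mulVec w G H) k
    rw [hGH, Matrix.one_mulVec] at this
    exact this
  rw [Matrix.mul_apply, ← h fun l => D i (G j l) + D j (G i l) - D l (G i j), Finset.smul_sum]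
  simp only [connMatrix, Matrix.of_apply, mul_smul_comm]

/-- This is ∇g = 0: in the sum of two lowered Christoffel symbols with k and j exchanged, only the
derivative in direction i survives. -/
theorem map_metric (hG : G.IsSymm) (hGH : G * H = 1) (i : ι) :
    G.map (D i) = G * connMatrix D G H i + (connMatrix D G H i).transpose * G := by
  ext k j
  have h : ((connMatrix D G H i).transpose * G) k j = (G * connMatrix D G H i) j k := by
    rw [← Matrix.transpose_apply (G * connMatrix D G H i), Matrix.transpose_mul, hG.eq]
  rw [Matrix.add_apply, h, mul_connMatrix_apply hGH, mul_connMatrix_apply hGH, Matrix.map_apply,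
    hG.apply k j, ← smul_add]
  rw [show D i (G k j) + D j (G i k) - D k (G i j) + (D i (G k j) + D k (G i j) - D j (G i k))
    = (2 : ℝ) • D i (G k j) by rw [two_smul]; ring]
  simp [smul_smul]

theorem isSymm_inverse (hG : G.IsSymm) (hGH : G * H = 1) : H.IsSymm := by
  have h1 : H.transpose * G = 1 := by
    rw [← Matrix.transpose_one, ← hGH, Matrix.transpose_mul, hG.eq]
  exact left_inv_eq_right_inv h1 hGH

/-- The inverse metric is parallel too: differentiate `G * H = 1` and multiply by `H` on the left.
-/
theorem map_inverse_metric (hG : G.IsSymm) (hGH : G * H = 1) (i : ι) :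
    H.map (D i) = -(connMatrix D G H i * H) - H * (connMatrix D G H i).transpose := by
  have hHG : H * G = 1 := mul_eq_one_comm.1 hGH
  have h := congrArg (fun M : Matrix ι ι A => H * M.map (D i)) hGH
  simp only [map_derivation_mul, map_derivation_one, Matrix.mul_zero, map_metric hG hGH i] at h
  set C := connMatrix D G H i
  have e : H * ((G * C + C.transpose * G) * H + G * H.map (D i))
      = (H * G) * (C * H) + H * C.transpose * (G * H) + (H * G) * H.map (D i) := by noncomm_ring
  rw [e, hHG, hGH] at h
  rw [← sub_eq_zero, ← h]
  noncomm_ring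

theorem map_map_comm (hD : ∀ i j f, D i (D j f) = D j (D i f)) (M : Matrix ι ι A) (i j : ι) :
    (M.map (D i)).map (D j) = (M.map (D j)).map (D i) := by
  ext k l; exact hD j i _

/-- The Ricci identity for the parallel tensor `H`: equality of its mixed second derivatives,
expanded by `map_inverse_metric`, says that the curvature acts on `H` by zero. -/
theorem curvMatrix_mul_inverse_antisymm (hG : G.IsSymm) (hGH : G * H = 1)
    (hD : ∀ i j f, D i (D j f) = D j (D i f)) (i j : ι) :
    (curvMatrix D G H i j * H).transpose = -(curvMatrix D G H i j * H) := by
  have h := map_map_comm hD H i j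
  have tr : ∀ (M : Matrix ι ι A) (k : ι), M.transpose.map (D k) = (M.map (D k)).transpose :=
    fun _ _ => rfl
  have ng : ∀ (M : Matrix ι ι A) (k : ι), (-M).map (D k) = -(M.map (D k)) := fun M k => by
    ext; simp
  rw [map_inverse_metric hG hGH i, map_inverse_metric hG hGH j] at h
  simp only [map_derivation_sub, ng, map_derivation_mul, tr] at h
  rw [map_inverse_metric hG hGH i, map_inverse_metric hG hGH j] at h
  rw [Matrix.transpose_mul, (isSymm_inverse hG hGH).eq, curvMatrix]
  simp only [Matrix.transpose_add, Matrix.transpose_sub, Matrix.transpose_mul]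
  rw [← sub_eq_zero] at h ⊢
  rw [← h]
  noncomm_ring

theorem curvMatrix_swap (i j : ι) : curvMatrix D G H i j = -curvMatrix D G H j i := by
  simp only [curvMatrix]; noncomm_ring

/-- The curvature is taken with its second matrix index raised. Only the connection terms of the two
upper indices appear, because those of the lower indices cancel in the cyclic sum. -/
theorem bianchi_two (hG : G.IsSymm) (hGH : G * H = 1)
    (hD : ∀ i j f, D i (D j f) = D j (D i f)) (a i j : ι) :
    ((curvMatrix D G H i j * H).map (D a) + connMatrix D G H a * (curvMatrix D G H i j * H)
        + curvMatrix D G H i j * H * (connMatrix D G H a).transpose)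
      + ((curvMatrix D G H j a * H).map (D i) + connMatrix D G H i * (curvMatrix D G H j a * H)
        + curvMatrix D G H j a * H * (connMatrix D G H i).transpose)
      + ((curvMatrix D G H a i * H).map (D j) + connMatrix D G H j * (curvMatrix D G H a i * H)
        + curvMatrix D G H a i * H * (connMatrix D G H j).transpose) = 0 := by
  simp only [map_derivation_mul, map_inverse_metric hG hGH]
  simp only [curvMatrix, map_derivation_mul, map_derivation_add, map_derivation_sub]
  rw [map_map_comm hD _ i a, map_map_comm hD _ j a, map_map_comm hD _ j i]
  noncomm_ring

theorem trace_curvMatrix (hG : G.IsSymm) (hGH : G * H = 1)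
    (hD : ∀ i j f, D i (D j f) = D j (D i f)) (i j : ι) : (curvMatrix D G H i j).trace = 0 := by
  have hHG : H * G = 1 := mul_eq_one_comm.1 hGH
  have h := curvMatrix_mul_inverse_antisymm hG hGH hD i j
  set C := curvMatrix D G H i j
  have e : C.trace = -C.trace := by
    calc C.trace = (C * H * G).trace := by rw [Matrix.mul_assoc, hHG, Matrix.mul_one]
      _ = ((C * H * G).transpose).trace := (Matrix.trace_transpose _).symm
      _ = (G * -(C * H)).trace := by rw [Matrix.transpose_mul, h, hG.eq]
      _ = -C.trace := by
        rw [Matrix.trace_mul_comm, Matrix.neg_mul, Matrix.mul_assoc, hHG, Matrix.mul_one,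
          Matrix.trace_neg]
  -- The factor 2 is cancelled through the real scalar 1/2, which any ℝ-algebra provides.
  have e2 : (2 : ℝ) • C.trace = 0 := by rw [two_smul]; nth_rw 2 [e]; ring
  simpa [smul_smul] using congrArg (fun x => (1 / 2 : ℝ) • x) e2

theorem ricMatrix_isSymm (hG : G.IsSymm) (hGH : G * H = 1)
    (hD : ∀ i j f, D i (D j f) = D j (D i f)) : (ricMatrix D G H).IsSymm := by
  -- The only term of the Ricci tensor not visibly symmetric is the derivative of tr Γ. Its symmetry
  -- is the vanishing of the trace of the curvature, since commutators are traceless.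
  have hc : ∀ i j, D i (connMatrix D G H j).trace = D j (connMatrix D G H i).trace := by
    intro i j
    have h := trace_curvMatrix hG hGH hD i j
    rw [curvMatrix, Matrix.trace_add, Matrix.trace_sub, Matrix.trace_sub,
      Matrix.trace_mul_comm (connMatrix D G H i), sub_self, add_zero, sub_eq_zero] at h
    simpa [Matrix.trace] using h
  refine Matrix.IsSymm.ext fun j k => ?_
  have key : ∀ j k, ricMatrix D G H j k = ∑ i, D i (connMatrix D G H j i k)
      - D j (connMatrix D G H k).trace + (∑ p, (connMatrix D G H p).trace * connMatrix D G H j p k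
      - ∑ i, ∑ p, connMatrix D G H j i p * connMatrix D G H k p i) := by
    intro j k
    simp only [ricMatrix, curvMatrix, Matrix.of_apply, Matrix.add_apply, Matrix.sub_apply,
      Finset.sum_add_distrib, Finset.sum_sub_distrib, Matrix.map_apply, Matrix.mul_apply]
    rw [Finset.sum_comm (f := fun i p => connMatrix D G H i i p * connMatrix D G H j p k)]
    simp only [← Finset.sum_mul, ← map_sum, trace_connMatrix hG]
    congr 2
    refine Finset.sum_congr rfl fun a _ => Finset.sum_congr rfl fun p _ => ?_
    rw [connMatrix_comm hG a k p]
  rw [key, key, hc j k, Finset.sum_comm]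
  congr 1
  · congr 1
    exact Finset.sum_congr rfl fun i _ => by rw [connMatrix_comm hG]
  · congr 1
    · exact Finset.sum_congr rfl fun i _ => by rw [connMatrix_comm hG]
    · exact Finset.sum_congr rfl fun i _ => Finset.sum_congr rfl fun p _ => mul_comm _ _

theorem sum_antisymm_mul_symm (P S : ι → ι → A) (hP : ∀ a b, P a b = -P b a)
    (hS : ∀ a b, S a b = S b a) : ∑ a, ∑ b, P a b * S a b = 0 := by
  have e : ∑ a, ∑ b, P a b * S a b = -∑ a, ∑ b, P a b * S a b := by
    conv_lhs => rw [Finset.sum_comm]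
    rw [← Finset.sum_neg_distrib]
    refine Finset.sum_congr rfl fun a _ => ?_
    rw [← Finset.sum_neg_distrib]
    refine Finset.sum_congr rfl fun b _ => ?_
    rw [hP b a, hS b a, neg_mul]
  have e2 : (2 : ℝ) • ∑ a, ∑ b, P a b * S a b = 0 := by rw [two_smul]; nth_rw 2 [e]; ring
  simpa [smul_smul] using congrArg (fun x => (1 / 2 : ℝ) • x) e2

/-- The contracted second Bianchi identity `2 div Ric = ∇ R`. -/
theorem two_mul_divTensor_ric (hG : G.IsSymm) (hGH : G * H = 1)
    (hD : ∀ i j f, D i (D j f) = D j (D i f)) (i : ι) :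
    2 * divTensor D G H (ricMatrix D G H * H) i = D i (ricMatrix D G H * H).trace := by
  set Q := ricMatrix D G H * H with hQ
  set Γ := connMatrix D G H with hΓ
  set P : ι → ι → Matrix ι ι A := fun i j => curvMatrix D G H i j * H with hPdef
  have hP : ∀ i j k l, P i j k l = -P i j l k := fun i j k l => by
    have := congrFun (congrFun (curvMatrix_mul_inverse_antisymm hG hGH hD i j) l) k
    simpa using this
  have hP' : ∀ i j k l, P i j k l = -P j i k l := fun i j k l => by
    simp only [hPdef]; rw [curvMatrix_swap i j]; simp
  have hPQ : ∀ j k, ∑ a, P a j a k = Q j k := fun j k => by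
    simp only [hPdef, hQ, Matrix.mul_apply, ricMatrix, Matrix.of_apply, Finset.sum_mul]
    exact Finset.sum_comm
  have hPQ' : ∀ j k, ∑ a, P j a a k = -Q j k := fun j k => by
    rw [← hPQ, ← Finset.sum_neg_distrib]
    exact Finset.sum_congr rfl fun a _ => hP' _ _ _ _
  have hPQ2 : ∀ j k, ∑ a, P j a k a = Q j k := fun j k => by
    rw [← hPQ]
    exact Finset.sum_congr rfl fun a _ => by rw [hP', hP, neg_neg]
  have hPQ2' : ∀ j k, ∑ a, P a j k a = -Q j k := fun j k => by
    rw [← hPQ, ← Finset.sum_neg_distrib]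
    exact Finset.sum_congr rfl fun a _ => hP _ _ _ _
  -- Contract the Bianchi identity twice, the directions a and j against the two upper indices. Of
  -- the nine resulting sums, `t5` and `t8` vanish as antisymmetric curvature against symmetric Γ;
  -- the others assemble into two divergences of Ric and the derivative of its trace.
  have hb : ∑ a, ∑ j, _ = (0 : A) := Finset.sum_eq_zero fun a _ => Finset.sum_eq_zero fun j _ =>
    congrFun (congrFun (bianchi_two hG hGH hD a i j) a) j
  simp only [Matrix.add_apply, Matrix.map_apply, Finset.sum_add_distrib] at hb
  have t1 : ∑ a, ∑ j, D a (P i j a j) = ∑ a, D a (Q i a) :=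
    Finset.sum_congr rfl fun a _ => by rw [← map_sum, hPQ2]
  have t2 : ∑ a, ∑ j, D i (P j a a j) = -D i Q.trace := by
    simp only [← map_sum, Matrix.trace, Matrix.diag_apply, ← map_neg]
    congr 1
    rw [← Finset.sum_neg_distrib]
    exact Finset.sum_congr rfl fun a _ => hPQ2' _ _
  have t3 : ∑ a, ∑ j, D j (P a i a j) = ∑ a, D a (Q i a) := by
    rw [Finset.sum_comm]
    exact Finset.sum_congr rfl fun a _ => by rw [← map_sum, hPQ]
  have t4 : ∑ a, ∑ j, (Γ a * P i j) a j = ∑ p, (Γ p).trace * Q i p := by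
    simp only [Matrix.mul_apply]
    calc _ = ∑ a, ∑ p, Γ a a p * Q i p := Finset.sum_congr rfl fun a _ => by
          rw [Finset.sum_comm]
          exact Finset.sum_congr rfl fun p _ => by rw [← Finset.mul_sum, hPQ2]
      _ = _ := by
          rw [Finset.sum_comm]
          exact Finset.sum_congr rfl fun p _ => by rw [← Finset.sum_mul, trace_connMatrix hG]
  have t5 : ∑ a, ∑ j, (P i j * (Γ a).transpose) a j = 0 := by
    simp only [Matrix.mul_apply, Matrix.transpose_apply]
    rw [Finset.sum_comm]
    exact Finset.sum_eq_zero fun j _ => sum_antisymm_mul_symm (fun a p => P i j a p)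
      (fun a p => Γ a j p) (fun a p => hP _ _ _ _) (fun a p => connMatrix_comm hG _ _ _)
  have t6 : ∑ a, ∑ j, (Γ i * P j a) a j = -∑ a, ∑ p, Γ i a p * Q a p := by
    simp only [Matrix.mul_apply, ← Finset.sum_neg_distrib]
    refine Finset.sum_congr rfl fun a _ => ?_
    rw [Finset.sum_comm]
    exact Finset.sum_congr rfl fun p _ => by rw [← Finset.mul_sum, hPQ2', mul_neg]
  have t7 : ∑ a, ∑ j, (P j a * (Γ i).transpose) a j = -∑ a, ∑ p, Γ i a p * Q a p := by
    simp only [Matrix.mul_apply, Matrix.transpose_apply, ← Finset.sum_neg_distrib]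
    rw [Finset.sum_comm]
    refine Finset.sum_congr rfl fun j _ => ?_
    rw [Finset.sum_comm]
    exact Finset.sum_congr rfl fun p _ => by rw [← Finset.sum_mul, hPQ', neg_mul, mul_comm]
  have t8 : ∑ a, ∑ j, (Γ j * P a i) a j = 0 := by
    simp only [Matrix.mul_apply]
    refine Finset.sum_eq_zero fun a _ => ?_
    rw [← sum_antisymm_mul_symm (fun j p => P a i p j) (fun j p => Γ j a p)
      (fun j p => hP _ _ _ _) (fun j p => connMatrix_comm hG _ _ _)]
    exact Finset.sum_congr rfl fun j _ => Finset.sum_congr rfl fun p _ => mul_comm _ _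
  have t9 : ∑ a, ∑ j, (P a i * (Γ j).transpose) a j = ∑ p, (Γ p).trace * Q i p := by
    simp only [Matrix.mul_apply, Matrix.transpose_apply]
    calc _ = ∑ j, ∑ p, Q i p * Γ j j p := by
          rw [Finset.sum_comm]
          refine Finset.sum_congr rfl fun j _ => ?_
          rw [Finset.sum_comm]
          exact Finset.sum_congr rfl fun p _ => by rw [← Finset.sum_mul, hPQ]
      _ = _ := by
          rw [Finset.sum_comm]
          exact Finset.sum_congr rfl fun p _ => by
            rw [← Finset.mul_sum, trace_connMatrix hG, mul_comm]
  simp only [hPdef] at t1 t2 t3 t4 t5 t6 t7 t8 t9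
  rw [t1, t2, t3, t4, t5, t6, t7, t8, t9] at hb
  rw [divTensor]
  linear_combination hb

/-- The covariant derivative of the gradient is the Hessian with an index raised. -/
theorem covDeriv_gradient (hG : G.IsSymm) (hGH : G * H = 1) (f : A) (i k : ι) :
    (hessMatrix D G H f * H) i k = D i (∑ j, H k j * D j f)
      + ∑ p, connMatrix D G H i k p * ∑ j, H p j * D j f := by
  have hH := isSymm_inverse hG hGH
  have h : ∀ j, D i (H k j) = -∑ p, connMatrix D G H i k p * H p j
      - ∑ p, H k p * connMatrix D G H i j p := fun j => by
    have := congrFun (congrFun (map_inverse_metric (D := D) hG hGH i) k) j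
    simpa [Matrix.mul_apply] using this
  simp only [map_sum, Derivation.leibniz, smul_eq_mul, h, Matrix.mul_apply, hessMatrix,
    Matrix.of_apply, mul_sub, sub_mul, Finset.sum_add_distrib, Finset.sum_sub_distrib,
    Finset.mul_sum, Finset.sum_mul, mul_neg, Finset.sum_neg_distrib]
  have e1 : ∑ x, ∑ p, D x f * (connMatrix D G H i k p * H p x)
      = ∑ x, ∑ p, connMatrix D G H i k x * (H x p * D p f) := by
    rw [Finset.sum_comm]
    exact Finset.sum_congr rfl fun _ _ => Finset.sum_congr rfl fun _ _ => by ring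
  have e2 : ∑ x, ∑ p, D x f * (H k p * connMatrix D G H i x p)
      = ∑ x, ∑ p, connMatrix D G H i p x * D p f * H x k := by
    rw [Finset.sum_comm]
    exact Finset.sum_congr rfl fun a _ => Finset.sum_congr rfl fun b _ => by
      rw [hH.apply k a]; ring
  have e3 : ∑ x, D i (D x f) * H x k = ∑ x, H k x * D i (D x f) :=
    Finset.sum_congr rfl fun a _ => by rw [hH.apply k a]; ring
  rw [e1, e2, e3]
  ring

/-- The Bochner formula `div ∇² f = ∇ Δ f + Ric (∇ f)`. -/
theorem divTensor_hess (hG : G.IsSymm) (hGH : G * H = 1)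
    (hD : ∀ i j f, D i (D j f) = D j (D i f)) (f : A) (i : ι) :
    divTensor D G H (hessMatrix D G H f * H) i = D i (hessMatrix D G H f * H).trace
      + ∑ k, ricMatrix D G H i k * ∑ j, H k j * D j f := by
  set N := hessMatrix D G H f * H with hN
  set Γ := connMatrix D G H with hΓ
  set v : ι → A := fun k => ∑ j, H k j * D j f with hv
  have hNv : ∀ i k, N i k = D i (v k) + ∑ p, Γ i k p * v p := covDeriv_gradient hG hGH f
  -- The Ricci identity for the gradient field v, before summation over a: second derivatives of v
  -- cancel because the derivations commute.
  have key : ∀ a, D a (N i a) + ∑ p, Γ a a p * N i p - D i (N a a) - ∑ p, Γ i a p * N a p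
      = ∑ k, curvMatrix D G H a i a k * v k := by
    intro a
    have e : ∀ a i k : ι, ∑ x, Γ a k x * ∑ p, Γ i x p * v p = ∑ p, (Γ a * Γ i) k p * v p := by
      intro a i k
      simp only [Matrix.mul_apply, Finset.sum_mul, Finset.mul_sum]
      rw [Finset.sum_comm]
      exact Finset.sum_congr rfl fun _ _ => Finset.sum_congr rfl fun _ _ => by ring
    simp only [hNv, curvMatrix, Matrix.add_apply, Matrix.sub_apply, Matrix.map_apply, map_add,
      map_sum, Derivation.leibniz, smul_eq_mul, mul_add, Finset.sum_add_distrib, add_mul, sub_mul,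
      Finset.sum_sub_distrib, e, ← hΓ, hD i a]
    simp only [mul_comm]
    ring
  have hs := Finset.sum_congr (rfl : (Finset.univ : Finset ι) = _) fun a _ => key a
  simp only [Finset.sum_add_distrib, Finset.sum_sub_distrib] at hs
  rw [divTensor]
  have e1 : ∑ a, ∑ p, Γ a a p * N i p = ∑ p, (Γ p).trace * N i p := by
    rw [Finset.sum_comm]
    exact Finset.sum_congr rfl fun p _ => by rw [← Finset.sum_mul, trace_connMatrix hG]
  have e2 : ∑ a, D i (N a a) = D i N.trace := by simp [Matrix.trace]
  have e3 : ∑ a, ∑ k, curvMatrix D G H a i a k * v k = ∑ k, ricMatrix D G H i k * v k := by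
    rw [Finset.sum_comm]
    exact Finset.sum_congr rfl fun p _ => by rw [← Finset.sum_mul]; rfl
  rw [e1, e2, e3] at hs
  linear_combination hs

/-- The product rule, combined with the fact that the identity endomorphism is parallel. It computes
the divergence of the right-hand side of the quasi-Einstein equation. -/
theorem divTensor_smul_sub (f : A) (c : ℝ) (N : Matrix ι ι A) (i : ι) :
    divTensor D G H (f • (N - c • (1 : Matrix ι ι A))) i
      = f * divTensor D G H N i + ∑ a, D a f * N i a - c • D i f := by
  have h1 : ∑ a, D a f * (1 : Matrix ι ι A) i a = D i f := by simp [Matrix.one_apply]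
  have h2 : ∑ p, (connMatrix D G H p).trace * (1 : Matrix ι ι A) i p
      = (connMatrix D G H i).trace := by simp [Matrix.one_apply]
  have h3 : ∑ a, ∑ p, connMatrix D G H i a p * (1 : Matrix ι ι A) a p
      = (connMatrix D G H i).trace := by simp [Matrix.one_apply, Matrix.trace]
  have h4 : ∑ a, D a ((1 : Matrix ι ι A) i a) = 0 := by
    refine Finset.sum_eq_zero fun a _ => ?_
    exact congrFun (congrFun (map_derivation_one (D a)) i) a
  have l1 : ∑ a, D a ((f • (N - c • (1 : Matrix ι ι A))) i a) = f * ∑ a, D a (N i a)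
      + ∑ a, D a f * N i a - c • ∑ a, D a f * (1 : Matrix ι ι A) i a
      - c • (f * ∑ a, D a ((1 : Matrix ι ι A) i a)) := by
    simp only [Matrix.smul_apply, Matrix.sub_apply, smul_eq_mul, Derivation.leibniz, map_sub,
      Derivation.map_smul, Finset.mul_sum, Finset.smul_sum, ← Finset.sum_add_distrib,
      ← Finset.sum_sub_distrib]
    refine Finset.sum_congr rfl fun a _ => ?_
    simp only [Algebra.smul_def]; ring
  have l2 : ∀ w : ι → A, ∀ j, ∑ p, w p * (f • (N - c • (1 : Matrix ι ι A))) j p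
      = f * ∑ p, w p * N j p - c • (f * ∑ p, w p * (1 : Matrix ι ι A) j p) := by
    intro w j
    simp only [Matrix.smul_apply, Matrix.sub_apply, smul_eq_mul, Finset.mul_sum,
      Finset.smul_sum, ← Finset.sum_sub_distrib]
    refine Finset.sum_congr rfl fun a _ => ?_
    simp only [Algebra.smul_def]; ring
  rw [divTensor, l1, l2]
  simp only [l2]
  rw [Finset.sum_sub_distrib, ← Finset.mul_sum, ← Finset.smul_sum, ← Finset.mul_sum, h1, h2, h3, h4,
    divTensor]
  simp only [Algebra.smul_def]
  ring

variable {f : A} {m lam R : ℝ}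

/-- The gradient of the potential of a quasi-Einstein metric of constant scalar curvature is an
eigenvector of the Ricci tensor. -/
theorem ric_gradient (hG : G.IsSymm) (hGH : G * H = 1)
    (hD : ∀ i j f, D i (D j f) = D j (D i f)) (hm : m ≠ 0)
    (hE : hessMatrix D G H f = m⁻¹ • f • (ricMatrix D G H - lam • G))
    (hR : (ricMatrix D G H * H).trace = algebraMap ℝ A R) (i : ι) :
    (m - 1) • ∑ k, ricMatrix D G H i k * ∑ j, H k j * D j f
      = ((Fintype.card ι - 1) * lam - R) • D i f := by
  have hN : hessMatrix D G H f * H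
      = (m⁻¹ • f) • (ricMatrix D G H * H - lam • (1 : Matrix ι ι A)) := by
    rw [hE, ← hGH]
    simp [sub_mul]
  have hB := divTensor_hess hG hGH hD f i
  have hQ := two_mul_divTensor_ric hG hGH hD i
  have hQ0 : divTensor D G H (ricMatrix D G H * H) i = 0 := by
    rw [hR, Derivation.map_algebraMap] at hQ
    have : (2 : ℝ) • divTensor D G H (ricMatrix D G H * H) i = 0 := by rw [two_smul, ← two_mul, hQ]
    simpa [smul_smul] using congrArg (fun x => (1 / 2 : ℝ) • x) this
  have hS : ∑ a, D a f * (ricMatrix D G H * H) i a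
      = ∑ k, ricMatrix D G H i k * ∑ j, H k j * D j f := by
    simp only [Matrix.mul_apply, Finset.mul_sum]
    rw [Finset.sum_comm]
    exact Finset.sum_congr rfl fun _ _ => Finset.sum_congr rfl fun _ _ => by ring
  have hS' : ∑ a, D a (m⁻¹ • f) * (ricMatrix D G H * H) i a
      = m⁻¹ • ∑ k, ricMatrix D G H i k * ∑ j, H k j * D j f := by
    rw [← hS, Finset.smul_sum]
    exact Finset.sum_congr rfl fun _ _ => by simp
  rw [hN, divTensor_smul_sub, hQ0, hS', Matrix.trace_smul, Matrix.trace_sub, hR,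
    Matrix.trace_smul, Matrix.trace_one] at hB
  set X := ∑ k, ricMatrix D G H i k * ∑ j, H k j * D j f
  have hc : algebraMap ℝ A R - lam • (Fintype.card ι : A)
      = algebraMap ℝ A (R - lam * Fintype.card ι) := by
    simp [Algebra.smul_def]
  rw [hc, smul_eq_mul, mul_comm (m⁻¹ • f) (algebraMap ℝ A _), ← Algebra.smul_def] at hB
  simp only [Derivation.map_smul, mul_zero, zero_add, smul_smul] at hB
  -- Bochner now reads (Ric(∇f) - λ∇f)/m = (R - nλ)∇f/m + Ric(∇f); multiplying by -m clears the
  -- denominators.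
  have := congrArg (fun x => (-m) • x) hB
  simp only [smul_sub, smul_add, smul_smul] at this
  have e1 : -m * m⁻¹ = -1 := by field_simp
  have e2 : -m * (lam * m⁻¹) = -lam := by field_simp
  have e3 : -m * ((R - lam * Fintype.card ι) * m⁻¹) = -(R - lam * Fintype.card ι) := by field_simp
  rw [e1, e2, e3] at this
  simp only [Algebra.smul_def, map_neg, map_sub, map_mul, map_one, map_natCast] at this ⊢
  linear_combination this

/-- Compute div(Ric(∇f)) twice. As div Ric = 0 it equals ⟨Ric, ∇²f⟩, and as Ric(∇f) = μ∇f it equals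
μΔf; then substitute the equation for ∇²f. The factor f remains because f may vanish. -/
theorem ric_norm_sq (hG : G.IsSymm) (hGH : G * H = 1)
    (hD : ∀ i j f, D i (D j f) = D j (D i f)) (hm : 1 < m)
    (hE : hessMatrix D G H f = m⁻¹ • f • (ricMatrix D G H - lam • G))
    (hR : (ricMatrix D G H * H).trace = algebraMap ℝ A R) :
    f * (ricMatrix D G H * H * (ricMatrix D G H * H)).trace
      = (lam * R + ((Fintype.card ι - 1) * lam - R) / (m - 1) * (R - lam * Fintype.card ι)) • f := by
  have hm0 : m ≠ 0 := by linarith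
  have hm1 : m - 1 ≠ 0 := by linarith
  set μ := ((Fintype.card ι - 1) * lam - R) / (m - 1) with hμ
  set v : ι → A := fun k => ∑ j, H k j * D j f with hv
  set N := hessMatrix D G H f * H with hN
  set Q := ricMatrix D G H * H with hQ
  set Γ := connMatrix D G H with hΓ
  have hH := isSymm_inverse hG hGH
  have hRs := ricMatrix_isSymm hG hGH hD
  have hNQ : N = (m⁻¹ • f) • (Q - lam • (1 : Matrix ι ι A)) := by
    rw [hN, hQ, hE, ← hGH]
    simp [sub_mul]
  have hNv : ∀ i k, N i k = D i (v k) + ∑ p, Γ i k p * v p := covDeriv_gradient hG hGH f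
  have hQ0 : ∀ i, divTensor D G H Q i = 0 := fun i => by
    have h := two_mul_divTensor_ric hG hGH hD i
    rw [hR, Derivation.map_algebraMap] at h
    have : (2 : ℝ) • divTensor D G H Q i = 0 := by rw [two_smul, ← two_mul, h]
    simpa [smul_smul] using congrArg (fun x => (1 / 2 : ℝ) • x) this
  have hric : ∀ i, ∑ k, ricMatrix D G H i k * v k = μ • D i f := fun i => by
    have h := congrArg (fun x => (m - 1)⁻¹ • x) (ric_gradient hG hGH hD hm0 hE hR i)
    simp only [smul_smul, inv_mul_cancel₀ hm1, one_smul] at h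
    rw [h, hμ]; congr 1; ring
  -- The eigenvector equation with its index raised; here the symmetry of Ric is used.
  have hw : ∀ a, ∑ i, v i * Q i a = μ • v a := fun a => by
    calc ∑ i, v i * Q i a = ∑ k, H a k * ∑ i, ricMatrix D G H k i * v i := by
          simp only [hQ, Matrix.mul_apply, Finset.mul_sum]
          rw [Finset.sum_comm]
          refine Finset.sum_congr rfl fun k _ => Finset.sum_congr rfl fun i _ => ?_
          rw [hRs.apply k i, hH.apply a k]; ring
      _ = μ • v a := by
          simp only [hric, mul_smul_comm, ← Finset.smul_sum]
          rfl
  have htr : ∑ a, D a (v a) + ∑ p, (Γ p).trace * v p = N.trace := by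
    simp only [Matrix.trace, Matrix.diag_apply, hNv, Finset.sum_add_distrib]
    congr 1
    rw [Finset.sum_comm]
    refine Finset.sum_congr rfl fun p _ => ?_
    rw [← Finset.sum_mul, trace_connMatrix hG]; rfl
  have hdiv : ∑ a, D a (∑ i, v i * Q i a) + ∑ p, (Γ p).trace * ∑ i, v i * Q i p
      = (Q * N).trace := by
    have hsum : ∑ i, v i * divTensor D G H Q i = 0 :=
      Finset.sum_eq_zero fun i _ => by rw [hQ0, mul_zero]
    simp only [divTensor, mul_sub, mul_add, Finset.sum_sub_distrib, Finset.sum_add_distrib] at hsum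
    rw [Matrix.trace]
    simp only [Matrix.diag_apply, Matrix.mul_apply, hNv, map_sum, Derivation.leibniz,
      smul_eq_mul, mul_add, Finset.sum_add_distrib]
    have e1 : ∑ i, v i * ∑ a, D a (Q i a) = ∑ a, ∑ i, v i * D a (Q i a) := by
      simp only [Finset.mul_sum]; exact Finset.sum_comm
    have e2 : ∑ i, v i * ∑ p, (Γ p).trace * Q i p = ∑ p, (Γ p).trace * ∑ i, v i * Q i p := by
      simp only [Finset.mul_sum]
      rw [Finset.sum_comm]
      exact Finset.sum_congr rfl fun _ _ => Finset.sum_congr rfl fun _ _ => by ring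
    have e3 : ∑ i, v i * ∑ a, ∑ p, Γ i a p * Q a p
        = ∑ a, ∑ p, Q a p * ∑ i, Γ p a i * v i := by
      simp only [Finset.mul_sum]
      rw [Finset.sum_comm]
      refine Finset.sum_congr rfl fun a _ => ?_
      rw [Finset.sum_comm]
      refine Finset.sum_congr rfl fun p _ => Finset.sum_congr rfl fun i _ => ?_
      rw [hΓ, connMatrix_comm hG i p a]; ring
    have e4 : ∑ a, ∑ i, Q i a * D a (v i) = ∑ i, ∑ a, Q i a * D a (v i) := Finset.sum_comm
    rw [← hΓ] at hsum
    rw [e1, e2, e3] at hsum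
    rw [e4]
    linear_combination hsum
  have hfin : (Q * N).trace = μ • N.trace := by
    rw [← hdiv, ← htr]
    simp only [hw, Derivation.map_smul, smul_add, Finset.smul_sum, mul_smul_comm]
  rw [hNQ, Matrix.mul_smul, mul_sub, Matrix.mul_smul, mul_one, Matrix.trace_smul,
    Matrix.trace_smul, Matrix.trace_sub, Matrix.trace_sub, Matrix.trace_smul, Matrix.trace_smul, hR,
    Matrix.trace_one] at hfin
  have := congrArg (fun x => m • x) hfin
  simp only [smul_eq_mul, smul_mul_assoc, smul_smul, mul_inv_cancel₀ hm0, one_smul,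
    show m * (μ * m⁻¹) = μ by field_simp] at this
  simp only [Algebra.smul_def, map_add, map_sub, map_mul, map_natCast] at this ⊢
  linear_combination this

end Algebraic

/-! ### Linear algebra of the Ricci tensor at one point. -/

section Pointwise

variable {ι : Type*} [Fintype ι] [DecidableEq ι]

open scoped MatrixOrder Matrix.Norms.L2Operator in
-- Factor H = CᵀC with C invertible. The trace is then the squared Frobenius norm of the symmetric
-- matrix Y = C B Cᵀ.
theorem eq_zero_of_trace_mul_sq_eq_zero {B H : Matrix ι ι ℝ} (hB : B.IsSymm) (hH : H.PosDef)
    (h : (B * H * (B * H)).trace = 0) : B = 0 := by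
  obtain ⟨C, hC⟩ : ∃ C : Matrix ι ι ℝ, H = C.conjTranspose * C := by
    obtain ⟨C, hC⟩ := CStarAlgebra.nonneg_iff_eq_star_mul_self.1 hH.posSemidef.nonneg
    exact ⟨C, hC⟩
  have hCu : IsUnit C := by
    have h1 : IsUnit H := hH.isUnit
    rw [hC] at h1
    exact isUnit_of_mul_isUnit_right h1
  set Y := C * B * C.conjTranspose with hY
  have hYs : Y.conjTranspose = Y := by
    rw [hY]
    simp only [Matrix.conjTranspose_eq_transpose_of_trivial, Matrix.transpose_mul,
      Matrix.transpose_transpose, hB.eq, Matrix.mul_assoc]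
  have h2 : (Y.conjTranspose * Y).trace = 0 := by
    rw [hYs, ← h, hC, hY, Matrix.mul_assoc C B, Matrix.mul_assoc C, Matrix.trace_mul_comm C]
    congr 1
    noncomm_ring
  have h3 : Y = 0 := Matrix.trace_conjTranspose_mul_self_eq_zero_iff.1 h2
  obtain ⟨c, rfl⟩ := hCu
  have hCt : IsUnit (c : Matrix ι ι ℝ).conjTranspose := c.isUnit.star
  rw [hY] at h3
  exact (Units.mul_right_eq_zero c).1 ((hCt.mul_left_eq_zero).1 h3)

variable {G Ric : Matrix ι ι ℝ} {d : ι → ℝ} {μ ρ : ℝ}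

/-- A symmetric form with eigenvector `d` is diagonal with a single eigenvalue on the orthogonal
complement of `d` if and only if its norm is the least possible. -/
theorem umbilic_iff_trace_sq (hG : G.PosDef) (hRic : Ric.IsSymm) (hd : d ≠ 0)
    (hμ : Ric.mulVec (G⁻¹.mulVec d) = μ • d)
    (hρ : (Ric * G⁻¹).trace = μ + (Fintype.card ι - 1) * ρ) :
    (∀ i j k, (Ric i k - ρ * G i k) * d j - (Ric j k - ρ * G j k) * d i = 0) ↔
      (Ric * G⁻¹ * (Ric * G⁻¹)).trace = μ ^ 2 + (Fintype.card ι - 1) * ρ ^ 2 := by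
  have hH : (G⁻¹).PosDef := hG.inv
  have hHs : (G⁻¹).transpose = G⁻¹ := by
    have := hH.isHermitian
    rwa [Matrix.IsHermitian, Matrix.conjTranspose_eq_transpose_of_trivial] at this
  have hGs : G.transpose = G := by
    have := hG.isHermitian
    rwa [Matrix.IsHermitian, Matrix.conjTranspose_eq_transpose_of_trivial] at this
  have hGdet : IsUnit G.det := (Matrix.isUnit_iff_isUnit_det _).1 hG.isUnit
  have hGH : G * G⁻¹ = 1 := Matrix.mul_nonsing_inv _ hGdet
  set H := G⁻¹ with hHdef
  set v := H.mulVec d with hv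
  set s := d ⬝ᵥ v with hs
  have hspos : 0 < s := by
    have := hH.dotProduct_mulVec_pos hd
    simpa using this
  have hGv : G.mulVec v = d := by rw [hv, Matrix.mulVec_mulVec, hGH, Matrix.one_mulVec]
  -- Chosen so that B = Ric - ρG - κ d⊗d annihilates v. Both sides of the equivalence are shown to
  -- mean B = 0.
  set κ := (μ - ρ) / s with hκ
  have hκs : κ * s = μ - ρ := by rw [hκ]; field_simp
  set W := Matrix.vecMulVec d v with hW
  set B := Ric - ρ • G - κ • Matrix.vecMulVec d d with hBdef
  have hBs : B.IsSymm := by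
    rw [Matrix.IsSymm, hBdef]
    simp [hRic.eq, hGs, Matrix.transpose_vecMulVec]
  have hBH : B * H = Ric * H - ρ • (1 : Matrix ι ι ℝ) - κ • W := by
    have : Matrix.vecMulVec d d * H = W := by
      rw [Matrix.vecMulVec_mul, hW, hv, ← Matrix.mulVec_transpose, hHs]
    rw [hBdef, sub_mul, sub_mul, Matrix.smul_mul, Matrix.smul_mul, hGH, this]
  have hQW : Ric * H * W = μ • W := by
    rw [hW, Matrix.mul_vecMulVec, ← Matrix.mulVec_mulVec, hμ, Matrix.smul_vecMulVec]
  have htW : W.trace = s := by rw [hW, Matrix.trace_vecMulVec]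
  have hWW : W * W = s • W := by
    rw [hW, Matrix.vecMulVec_mul_vecMulVec, dotProduct_comm]
    simp [hs, Matrix.vecMulVec_smul]
  -- The squared norm of B is exactly the excess of |Ric|² over its least possible value.
  have htr : (B * H * (B * H)).trace = (Ric * H * (Ric * H)).trace
      - (μ ^ 2 + (Fintype.card ι - 1) * ρ ^ 2) := by
    have e : B * H * (B * H) = Ric * H * (Ric * H) - (2 * ρ) • (Ric * H)
        + ρ ^ 2 • (1 : Matrix ι ι ℝ) - κ • (Ric * H * W) - κ • (W * (Ric * H))
        + (2 * ρ * κ) • W + κ ^ 2 • (W * W) := by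
      rw [hBH]
      simp only [sub_mul, mul_sub, Matrix.smul_mul, Matrix.mul_smul, one_mul, mul_one, smul_smul]
      module
    rw [e]
    simp only [Matrix.trace_add, Matrix.trace_sub, Matrix.trace_smul, Matrix.trace_mul_comm W,
      hQW, hWW, htW, hρ, Matrix.trace_one, smul_eq_mul]
    linear_combination (-2 * μ + 2 * ρ + κ * s + μ - ρ) * hκs
  have hB0 : B = 0 ↔ (B * H * (B * H)).trace = 0 :=
    ⟨fun h => by simp [h], eq_zero_of_trace_mul_sq_eq_zero hBs hH⟩
  rw [← sub_eq_zero (b := μ ^ 2 + _), ← htr, ← hB0]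
  constructor
  · intro h
    ext i k
    -- Contracting the index j with v isolates Ric - ρG, because d·v = s > 0.
    have h1 : ∑ j, ((Ric i k - ρ * G i k) * d j - (Ric j k - ρ * G j k) * d i) * v j = 0 :=
      Finset.sum_eq_zero fun j _ => by rw [h, zero_mul]
    have h2 : ∑ j, (Ric j k - ρ * G j k) * v j = (μ - ρ) * d k := by
      have a1 := congrFun hμ k
      have a2 := congrFun hGv k
      simp only [Matrix.mulVec, dotProduct, Pi.smul_apply, smul_eq_mul] at a1 a2
      rw [sub_mul, ← a1]
      conv_rhs => rw [← a2]
      rw [Finset.mul_sum, ← Finset.sum_sub_distrib]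
      refine Finset.sum_congr rfl fun j _ => ?_
      rw [hRic.apply k j, show G j k = G k j from congrFun (congrFun hGs k) j]; ring
    have h3 : (Ric i k - ρ * G i k) * s - (μ - ρ) * d k * d i = 0 := by
      rw [← h1, ← h2, hs, dotProduct, Finset.mul_sum, Finset.sum_mul, ← Finset.sum_sub_distrib]
      exact Finset.sum_congr rfl fun j _ => by ring
    have h4 : (Ric i k - ρ * G i k - κ * (d i * d k)) * s = 0 := by
      linear_combination h3 - d i * d k * hκs
    have h5 := (mul_eq_zero.1 h4).resolve_right hspos.ne'
    simpa [hBdef, Matrix.vecMulVec_apply] using h5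
  · intro h i j k
    have e : ∀ i, Ric i k - ρ * G i k = κ * (d i * d k) := fun i => by
      have := congrFun (congrFun h i) k
      simp only [hBdef, Matrix.sub_apply, Matrix.smul_apply, Matrix.vecMulVec_apply, smul_eq_mul,
        Matrix.zero_apply] at this
      linarith
    rw [e, e]; ring

end Pointwise

/-! ### Smooth functions on a coordinate domain, and partial derivatives as derivations. -/

section SmoothFunctions

variable {n : ℕ} {S : Set (EuclideanSpace ℝ (Fin n))}

/-- Extension by zero of a function on `S`. -/
def extendZero (f : S → ℝ) : EuclideanSpace ℝ (Fin n) → ℝ := Function.extend Subtype.val f 0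

theorem extendZero_apply (f : S → ℝ) (y : S) : extendZero f y = f y :=
  Subtype.val_injective.extend_apply _ _ _

theorem contDiffOn_extendZero {f : S → ℝ} {F : EuclideanSpace ℝ (Fin n) → ℝ}
    (hF : ContDiffOn ℝ ∞ F S) (h : ∀ y : S, f y = F y) : ContDiffOn ℝ ∞ (extendZero f) S :=
  hF.congr fun y hy => by rw [extendZero_apply f ⟨y, hy⟩, h]

variable (S) in
/-- The algebra of functions on `S` that are smooth up to the boundary. -/
def smoothFun : Subalgebra ℝ (S → ℝ) where
  carrier := {f | ContDiffOn ℝ ∞ (extendZero f) S}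
  mul_mem' {f g} hf hg := contDiffOn_extendZero (hf.mul hg) fun y => by simp [extendZero_apply]
  add_mem' {f g} hf hg := contDiffOn_extendZero (hf.add hg) fun y => by simp [extendZero_apply]
  algebraMap_mem' r := contDiffOn_extendZero (F := fun _ => r) contDiffOn_const fun y => rfl

/-- The restriction of a function to `S`. -/
def restrictSmooth (F : EuclideanSpace ℝ (Fin n) → ℝ) (hF : ContDiffOn ℝ ∞ F S) : smoothFun S :=
  ⟨fun y => F y, contDiffOn_extendZero hF fun _ => rfl⟩

theorem contDiffOn_of_eq (a : smoothFun S) {F : EuclideanSpace ℝ (Fin n) → ℝ}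
    (h : ∀ y : S, a.1 y = F y) : ContDiffOn ℝ ∞ F S :=
  ContDiffOn.congr a.2 fun y hy => by rw [extendZero_apply a.1 ⟨y, hy⟩, h]

theorem partialDeriv_congr {F F' : EuclideanSpace ℝ (Fin n) → ℝ} (h : EqOn F F' S) (i : Fin n)
    {y : EuclideanSpace ℝ (Fin n)} (hy : y ∈ S) : partialDeriv S F i y = partialDeriv S F' i y := by
  rw [partialDeriv, fderivWithin_congr h (h hy), partialDeriv]

theorem contDiffOn_partialDeriv (hS : UniqueDiffOn ℝ S) {F : EuclideanSpace ℝ (Fin n) → ℝ}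
    (hF : ContDiffOn ℝ ∞ F S) (i : Fin n) : ContDiffOn ℝ ∞ (partialDeriv S F i) S :=
  (hF.fderivWithin hS (m := ∞) (by simp)).clm_apply contDiffOn_const

/-- The partial derivative as a derivation of the algebra of smooth functions. -/
def partialDerivation (hS : UniqueDiffOn ℝ S) (i : Fin n) :
    Derivation ℝ (smoothFun S) (smoothFun S) :=
  Derivation.mk'
    { toFun := fun f => restrictSmooth _ (contDiffOn_partialDeriv hS f.2 i)
      map_add' := fun f g => by
        ext y
        change partialDeriv S (extendZero (f.1 + g.1)) i y
          = partialDeriv S (extendZero f.1) i y + partialDeriv S (extendZero g.1) i y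
        have hf := (f.2.differentiableOn (by simp)) y y.2
        have hg := (g.2.differentiableOn (by simp)) y y.2
        rw [partialDeriv_congr (F' := extendZero f.1 + extendZero g.1) _ i y.2]
        · rw [partialDeriv, fderivWithin_add (hS y y.2) hf hg]; rfl
        · intro z hz
          simp [extendZero_apply _ ⟨z, hz⟩]
      map_smul' := fun c f => by
        ext y
        change partialDeriv S (extendZero (c • f.1)) i y = c * partialDeriv S (extendZero f.1) i y
        have hf := (f.2.differentiableOn (by simp)) y y.2
        rw [partialDeriv_congr (F' := c • extendZero f.1) _ i y.2]
        · rw [partialDeriv, fderivWithin_const_smul (hS y y.2) hf]; rfl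
        · intro z hz
          simp [extendZero_apply _ ⟨z, hz⟩] }
    fun f g => by
      ext y
      change partialDeriv S (extendZero (f.1 * g.1)) i y
        = f.1 y * partialDeriv S (extendZero g.1) i y + g.1 y * partialDeriv S (extendZero f.1) i y
      have hf := (f.2.differentiableOn (by simp)) y y.2
      have hg := (g.2.differentiableOn (by simp)) y y.2
      rw [partialDeriv_congr (F' := extendZero f.1 * extendZero g.1) _ i y.2]
      · rw [partialDeriv, fderivWithin_mul (hS y y.2) hf hg]
        simp [extendZero_apply, partialDeriv]
      · intro z hz
        simp [extendZero_apply _ ⟨z, hz⟩]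

theorem partialDerivation_apply (hS : UniqueDiffOn ℝ S) (i : Fin n) (a : smoothFun S)
    {F : EuclideanSpace ℝ (Fin n) → ℝ} (h : ∀ y : S, a.1 y = F y) (y : S) :
    (partialDerivation hS i a).1 y = partialDeriv S F i y :=
  partialDeriv_congr (fun z hz => by rw [extendZero_apply a.1 ⟨z, hz⟩, h]) i y.2

/-- Both sides are values of the second derivative within S. Its symmetry holds at boundary points
as well, since these are limits of interior points. -/
theorem partialDerivation_comm (hS : UniqueDiffOn ℝ S) (hS' : S ⊆ closure (interior S))
    (i j : Fin n) (a : smoothFun S) :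
    partialDerivation hS i (partialDerivation hS j a)
      = partialDerivation hS j (partialDerivation hS i a) := by
  ext y
  have key : ∀ i j, (partialDerivation hS i (partialDerivation hS j a)).1 y
      = fderivWithin ℝ (fderivWithin ℝ (extendZero a.1) S) S y (stdVec i) (stdVec j) := by
    intro i j
    rw [partialDerivation_apply hS i _ (F := partialDeriv S (extendZero a.1) j)
      (fun z => partialDerivation_apply hS j a (fun w => (extendZero_apply _ w).symm) z)]
    have hd : DifferentiableWithinAt ℝ (fderivWithin ℝ (extendZero a.1) S) S y :=
      ((a.2.fderivWithin hS (m := ∞) (by simp)).differentiableOn (by simp)) y y.2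
    unfold partialDeriv
    rw [fderivWithin_clm_apply (hS y y.2) hd (differentiableWithinAt_const _)]
    simp
  rw [key, key]
  have hc : ContDiffWithinAt ℝ ∞ (extendZero a.1) S y := a.2 y y.2
  have hle : minSmoothness ℝ 2 ≤ (∞ : WithTop ℕ∞) := by
    rw [minSmoothness_of_isRCLikeNormedField]
    exact WithTop.coe_le_coe.2 (le_top : (2 : ℕ∞) ≤ ⊤)
  exact (hc.isSymmSndFDerivWithinAt hle hS (hS' y.2) y.2).eq _ _

/-- Evaluation at a point. -/
def evalAt (y : S) : smoothFun S →ₐ[ℝ] ℝ := (Pi.evalAlgHom ℝ (fun _ : S => ℝ) y).comp (smoothFun S).val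

theorem evalAt_apply (y : S) (a : smoothFun S) : evalAt y a = a.1 y := rfl

end SmoothFunctions

/-! ### Evaluating the algebraic curvature tensors gives the coordinate ones. -/

section Comparison

variable {n : ℕ} {S : Set (EuclideanSpace ℝ (Fin n))}
  {G : EuclideanSpace ℝ (Fin n) → Matrix (Fin n) (Fin n) ℝ}
  (hS : UniqueDiffOn ℝ S) {Gm Hm : Matrix (Fin n) (Fin n) (smoothFun S)}

theorem connMatrix_eval (hGm : ∀ i j y, (Gm i j).1 y = G y i j)
    (hHm : ∀ i j y, (Hm i j).1 y = (G y)⁻¹ i j) (k i j : Fin n) (y : S) :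
    (connMatrix (partialDerivation hS) Gm Hm i k j).1 y = christoffel S G k i j y := by
  have hd : ∀ i j k, (partialDerivation hS k (Gm i j)).1 y
      = partialDeriv S (fun z => G z i j) k y :=
    fun i j k => partialDerivation_apply hS k _ (F := fun z => G z i j) (hGm i j) y
  rw [← evalAt_apply]
  simp only [connMatrix, Matrix.of_apply, map_smul, map_sum, map_mul, map_sub, map_add,
    evalAt_apply, hHm, hd, christoffel, smul_eq_mul]

theorem curvMatrix_eval (hGm : ∀ i j y, (Gm i j).1 y = G y i j)
    (hHm : ∀ i j y, (Hm i j).1 y = (G y)⁻¹ i j) (l i j k : Fin n) (y : S) :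
    (curvMatrix (partialDerivation hS) Gm Hm i j l k).1 y = riemann S G l i j k y := by
  rw [← evalAt_apply]
  simp only [curvMatrix, Matrix.add_apply, Matrix.sub_apply, Matrix.map_apply, Matrix.mul_apply,
    map_sum, map_mul, map_sub, map_add, evalAt_apply,
    partialDerivation_apply hS _ _ (connMatrix_eval hS hGm hHm _ _ _),
    connMatrix_eval hS hGm hHm, riemann, ← Finset.sum_sub_distrib]
  congr 1
  exact Finset.sum_congr rfl fun p _ => by ring

theorem ricMatrix_eval (hGm : ∀ i j y, (Gm i j).1 y = G y i j)
    (hHm : ∀ i j y, (Hm i j).1 y = (G y)⁻¹ i j) (j k : Fin n) (y : S) :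
    (ricMatrix (partialDerivation hS) Gm Hm j k).1 y = ricci S G j k y := by
  rw [← evalAt_apply]
  simp only [ricMatrix, Matrix.of_apply, map_sum, evalAt_apply,
    curvMatrix_eval hS hGm hHm, ricci]

theorem hessMatrix_eval (hGm : ∀ i j y, (Gm i j).1 y = G y i j)
    (hHm : ∀ i j y, (Hm i j).1 y = (G y)⁻¹ i j) {f : EuclideanSpace ℝ (Fin n) → ℝ} (fm : smoothFun S)
    (hf : ∀ y, fm.1 y = f y) (i j : Fin n) (y : S) :
    (hessMatrix (partialDerivation hS) Gm Hm fm i j).1 y = hessian S G f i j y := by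
  rw [← evalAt_apply]
  simp only [hessMatrix, Matrix.of_apply, map_sum, map_mul, map_sub, evalAt_apply,
    connMatrix_eval hS hGm hHm, partialDerivation_apply hS _ _ hf,
    partialDerivation_apply hS _ _ (partialDerivation_apply hS _ _ hf), hessian]

end Comparison

/-! ### The equivalence at a point of a coordinate domain. -/

section Local

variable {n : ℕ} {S : Set (EuclideanSpace ℝ (Fin n))}
  {G : EuclideanSpace ℝ (Fin n) → Matrix (Fin n) (Fin n) ℝ}
  {f : EuclideanSpace ℝ (Fin n) → ℝ} {m lam R : ℝ}

/-- The determinant never vanishes on S, so its reciprocal is smooth, and Cramer's rule gives the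
inverse metric inside the algebra of smooth functions. -/
theorem exists_smooth_matrices (hG : ∀ i j, ContDiffOn ℝ ∞ (fun y => G y i j) S)
    (hpos : ∀ y ∈ S, (G y).PosDef) :
    ∃ Gm Hm : Matrix (Fin n) (Fin n) (smoothFun S), (∀ i j y, (Gm i j).1 y = G y i j) ∧
      (∀ i j y, (Hm i j).1 y = (G y)⁻¹ i j) ∧ Gm * Hm = 1 ∧ Gm.IsSymm := by
  set Gm : Matrix (Fin n) (Fin n) (smoothFun S) :=
    Matrix.of fun i j => restrictSmooth (fun y => G y i j) (hG i j) with hGm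
  have hGe : ∀ y : S, (evalAt y).toRingHom.mapMatrix Gm = G y := fun y => rfl
  have hdet : ∀ y : S, (Gm.det).1 y = (G y).det := fun y => by
    rw [← hGe, ← RingHom.map_det]; rfl
  have hne : ∀ y ∈ S, extendZero Gm.det.1 y ≠ 0 := fun y hy => by
    rw [extendZero_apply _ ⟨y, hy⟩, hdet]
    exact (hpos y hy).det_pos.ne'
  set δ : smoothFun S := restrictSmooth (fun y => (extendZero Gm.det.1 y)⁻¹)
    (ContDiffOn.inv Gm.det.2 hne) with hδ
  have hδe : ∀ y : S, evalAt y δ = (G y).det⁻¹ := fun y => by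
    change (extendZero Gm.det.1 y)⁻¹ = _
    rw [extendZero_apply, hdet]
  have hHe : ∀ y : S, (evalAt y).toRingHom.mapMatrix (δ • Gm.adjugate) = (G y)⁻¹ := fun y => by
    rw [Matrix.inv_def, ← hGe y, ← RingHom.map_adjugate, hGe, Ring.inverse_eq_inv', ← hδe]
    ext i j
    simp
  refine ⟨Gm, δ • Gm.adjugate, fun i j y => rfl, fun i j y => ?_, ?_, ?_⟩
  · rw [← hHe y]; rfl
  · ext i j y
    have h : (evalAt y).toRingHom.mapMatrix (Gm * δ • Gm.adjugate) = 1 := by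
      rw [map_mul, hGe, hHe, Matrix.mul_nonsing_inv _ (hpos y y.2).det_pos.ne'.isUnit]
    have h' : (evalAt y).toRingHom.mapMatrix (1 : Matrix (Fin n) (Fin n) (smoothFun S)) = 1 :=
      map_one _
    exact congrFun (congrFun (h.trans h'.symm) i) j
  · ext i j y
    have e : G y j i = G y i j := by
      simpa using congrFun (congrFun (hpos y y.2).isHermitian i) j
    exact e

variable (S G f m lam R) in
/-- A quasi-Einstein metric of constant scalar curvature `R` on a coordinate domain `S`. -/
structure IsLocalQuasiEinstein : Prop where
  uniqueDiffOn : UniqueDiffOn ℝ S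
  subset_closure : S ⊆ closure (interior S)
  smooth_metric : ∀ i j, ContDiffOn ℝ ∞ (fun y => G y i j) S
  posDef : ∀ y ∈ S, (G y).PosDef
  smooth : ContDiffOn ℝ ∞ f S
  one_lt : 1 < m
  equation : ∀ y ∈ S, ∀ i j, hessian S G f i j y = f y / m * (ricci S G i j y - lam * G y i j)
  scalar : ∀ y ∈ S, scalarCurv S G y = R

/-- The Ricci tensor at `y`, as a matrix. -/
def ricciAt (S : Set (EuclideanSpace ℝ (Fin n)))
    (G : EuclideanSpace ℝ (Fin n) → Matrix (Fin n) (Fin n) ℝ)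
    (y : EuclideanSpace ℝ (Fin n)) : Matrix (Fin n) (Fin n) ℝ :=
  Matrix.of fun i j => ricci S G i j y

/-- The algebraic identities of a quasi-Einstein metric of constant scalar curvature. -/
theorem IsLocalQuasiEinstein.identities (h : IsLocalQuasiEinstein S G f m lam R) :
    (∀ j k, ContDiffOn ℝ ∞ (ricci S G j k) S) ∧
    (∀ i j, ContDiffOn ℝ ∞ (fun y => (G y)⁻¹ i j) S) ∧
    ∀ y ∈ S, (ricciAt S G y).IsSymm ∧ (ricciAt S G y * (G y)⁻¹).trace = R ∧
      (∀ i, (m - 1) * ricciGrad S G f i y = ((n - 1) * lam - R) * partialDeriv S f i y) ∧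
      f y * (ricciAt S G y * (G y)⁻¹ * (ricciAt S G y * (G y)⁻¹)).trace
        = (lam * R + ((n - 1) * lam - R) / (m - 1) * (R - lam * n)) * f y := by
  obtain ⟨Gm, Hm, hGm, hHm, hGH, hGs⟩ := exists_smooth_matrices h.smooth_metric h.posDef
  have hS := h.uniqueDiffOn
  have hD := fun i j f => partialDerivation_comm hS h.subset_closure i j f
  have hm0 : m ≠ 0 := by linarith [h.one_lt]
  set fm : smoothFun S := restrictSmooth f h.smooth with hfm
  set Ric := ricMatrix (partialDerivation hS) Gm Hm with hRic
  have hRice : ∀ i j (y : S), (Ric i j).1 y = ricci S G i j y :=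
    fun i j y => ricMatrix_eval hS hGm hHm i j y
  have hRe : ∀ y : S, (evalAt y).toRingHom.mapMatrix Ric = ricciAt S G y := fun y => by
    ext i j; exact hRice i j y
  have hHe : ∀ y : S, (evalAt y).toRingHom.mapMatrix Hm = (G y)⁻¹ := fun y => by
    ext i j; exact hHm i j y
  have hRs : Ric.IsSymm := ricMatrix_isSymm hGs hGH hD
  have hRsy : ∀ y : S, (ricciAt S G y).IsSymm := fun y => by
    rw [← hRe, Matrix.IsSymm]
    conv_rhs => rw [← hRs.eq]
    rfl
  have htry : ∀ y : S, (ricciAt S G y * (G y)⁻¹).trace = R := fun y => by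
    rw [← h.scalar y y.2, scalarCurv, Matrix.trace]
    simp only [Matrix.diag_apply, Matrix.mul_apply]
    rw [Finset.sum_comm]
    refine Finset.sum_congr rfl fun i _ => Finset.sum_congr rfl fun j _ => ?_
    rw [(hRsy y).apply i j, mul_comm]; rfl
  have htr : (Ric * Hm).trace = algebraMap ℝ (smoothFun S) R := by
    ext y
    have e : evalAt y (Ric * Hm).trace = (ricciAt S G y * (G y)⁻¹).trace := by
      rw [← hRe, ← hHe, ← map_mul, Matrix.trace, map_sum]; rfl
    exact e.trans (htry y)
  have hE : hessMatrix (partialDerivation hS) Gm Hm fm = m⁻¹ • fm • (Ric - lam • Gm) := by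
    ext i j y
    rw [hessMatrix_eval hS hGm hHm fm (fun _ => rfl), h.equation y y.2]
    change _ = m⁻¹ * (f y * ((Ric i j).1 y - lam * (Gm i j).1 y))
    rw [hRice, hGm]
    ring
  refine ⟨fun j k => contDiffOn_of_eq _ (hRice j k), fun i j => contDiffOn_of_eq _ (hHm i j), ?_⟩
  intro y hy
  refine ⟨hRsy ⟨y, hy⟩, htry ⟨y, hy⟩, fun i => ?_, ?_⟩
  · have e := congrArg (evalAt ⟨y, hy⟩) (ric_gradient hGs hGH hD hm0 hE htr i)
    have hd : ∀ j, evalAt ⟨y, hy⟩ (partialDerivation hS j fm) = partialDeriv S f j y :=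
      fun j => partialDerivation_apply hS j fm (fun _ => rfl) ⟨y, hy⟩
    have hr : ∀ i j, evalAt ⟨y, hy⟩ (Ric i j) = ricci S G i j y := fun i j => hRice i j ⟨y, hy⟩
    have hh : ∀ i j, evalAt ⟨y, hy⟩ (Hm i j) = (G y)⁻¹ i j := fun i j => hHm i j ⟨y, hy⟩
    simp only [map_smul, map_sum, map_mul, hd, ← hRic, hr, hh, smul_eq_mul, Fintype.card_fin] at e
    rw [← e, ricciGrad]
    simp only [Finset.mul_sum, mul_assoc]
  · have e := congrArg (evalAt ⟨y, hy⟩) (ric_norm_sq hGs hGH hD h.one_lt hE htr)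
    rw [map_mul, map_smul, Fintype.card_fin] at e
    have e1 : evalAt ⟨y, hy⟩ (Ric * Hm * (Ric * Hm)).trace
        = (ricciAt S G y * (G y)⁻¹ * (ricciAt S G y * (G y)⁻¹)).trace := by
      rw [← hRe ⟨y, hy⟩, ← hHe ⟨y, hy⟩, ← map_mul, ← map_mul]; rw [Matrix.trace, map_sum]; rfl
    rw [e1] at e
    exact e

theorem IsLocalQuasiEinstein.continuousOn_tensorT (h : IsLocalQuasiEinstein S G f m lam R)
    (i j k : Fin n) : ContinuousOn (tensorT S G m lam f i j k) S := by
  obtain ⟨hr, hi, -⟩ := h.identities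
  have cr := fun j k => (hr j k).continuousOn
  have ci := fun j k => (hi j k).continuousOn
  have cg := fun j k => (h.smooth_metric j k).continuousOn
  have cf := h.smooth.continuousOn
  have cd := fun j => (contDiffOn_partialDeriv h.uniqueDiffOn h.smooth j).continuousOn
  have hs : ContDiffOn ℝ ∞ (scalarCurv S G) S := contDiffOn_const.congr h.scalar
  have cs := hs.continuousOn
  have csd := fun j => (contDiffOn_partialDeriv h.uniqueDiffOn hs j).continuousOn
  have crg : ∀ j, ContinuousOn (ricciGrad S G f j) S := fun j =>
    continuousOn_finsetSum _ fun l _ => continuousOn_finsetSum _ fun p _ =>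
      ((cr j l).mul (ci l p)).mul (cd p)
  refine ((ContinuousOn.add (continuousOn_const.mul ?_) (continuousOn_const.mul ?_)).add
    (ContinuousOn.mul ?_ ?_)).sub ((cf.div_const _).mul ?_)
  · exact ((cr i k).mul (cd j)).sub ((cr j k).mul (cd i))
  · exact ((crg j).mul (cg i k)).sub ((crg i).mul (cg j k))
  · exact (continuousOn_const.add (continuousOn_const.mul cs)).div_const _
  · exact ((cd i).mul (cg j k)).sub ((cd j).mul (cg i k))
  · exact ((csd i).mul (cg j k)).sub ((csd j).mul (cg i k))

/-- After replacing Ric(∇f) by μ df, the metric terms have total coefficient λ + mR/((n-1)(n-2)) -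
mμ/(n-2). The relation (n-1)λ = R + (m-1)μ turns it into (m+n-2)/(n-2) · (R-μ)/(n-1), the same
factor as in front of Ric. -/
theorem IsLocalQuasiEinstein.tensorT_eq (h : IsLocalQuasiEinstein S G f m lam R) (hn : 3 ≤ n)
    {y : EuclideanSpace ℝ (Fin n)} (hy : y ∈ S) {μ : ℝ} (hμ : (m - 1) * μ = (n - 1) * lam - R)
    (i j k : Fin n) :
    tensorT S G m lam f i j k y = (m + n - 2) / (n - 2) *
      ((ricciAt S G y i k - (R - μ) / (n - 1) * G y i k) * partialDeriv S f j y
        - (ricciAt S G y j k - (R - μ) / (n - 1) * G y j k) * partialDeriv S f i y) := by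
  obtain ⟨-, -, hid⟩ := h.identities
  obtain ⟨-, -, hg, -⟩ := hid y hy
  have hm1 : m - 1 ≠ 0 := by linarith [h.one_lt]
  have hn' : (3 : ℝ) ≤ n := by exact_mod_cast hn
  have hn1 : (n : ℝ) - 1 ≠ 0 := by linarith
  have hn2 : (n : ℝ) - 2 ≠ 0 := by linarith
  have hrg : ∀ i, ricciGrad S G f i y = μ * partialDeriv S f i y := fun i => by
    refine mul_left_cancel₀ hm1 ?_
    rw [hg, ← hμ]; ring
  have hds : ∀ i, partialDeriv S (scalarCurv S G) i y = 0 := fun i => by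
    rw [partialDeriv_congr (F' := fun _ => R) h.scalar i hy, partialDeriv]
    simp
  have hR : R = (n - 1) * lam - (m - 1) * μ := by linarith
  rw [tensorT, hrg, hrg, hds, hds, h.scalar y hy]
  simp only [ricciAt, Matrix.of_apply]
  rw [hR]
  field_simp
  ring

/-- Eliminating R, the difference of the two sides factors as m/(n-1) · μ((n-1)λ - (m+n-1)μ). The
factor μ vanishes when R = (n-1)λ, the other one at the remaining value. -/
theorem scalar_dichotomy (hn : 3 ≤ n) (hm : 1 < m) {μ : ℝ} (hμ : (m - 1) * μ = (n - 1) * lam - R) :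
    lam * R + μ * (R - lam * n) = μ ^ 2 + (n - 1) * ((R - μ) / (n - 1)) ^ 2 ↔
      (R = n * ((n : ℝ) - 1) / (m + n - 1) * lam ∨ R = ((n : ℝ) - 1) * lam) := by
  have hn' : (3 : ℝ) ≤ n := by exact_mod_cast hn
  have hn1 : (n : ℝ) - 1 ≠ 0 := by linarith
  have hm1 : m - 1 ≠ 0 := by linarith
  have hm0 : m ≠ 0 := by linarith
  have hmn : m + n - 1 ≠ 0 := by linarith
  have hR : R = (n - 1) * lam - (m - 1) * μ := by linarith
  have e1 : lam * R + μ * (R - lam * n) - (μ ^ 2 + (n - 1) * ((R - μ) / (n - 1)) ^ 2)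
      = m / (n - 1) * (μ * ((n - 1) * lam - μ * (m + n - 1))) := by
    rw [hR]; field_simp; ring
  rw [← sub_eq_zero, e1, mul_eq_zero, mul_eq_zero, or_iff_right (div_ne_zero hm0 hn1), or_comm]
  refine or_congr ?_ ?_
  · rw [div_mul_eq_mul_div, eq_div_iff hmn, ← sub_eq_zero (a := R * _), hR]
    have e2 : ((n - 1) * lam - (m - 1) * μ) * (m + n - 1) - n * (n - 1) * lam
        = (m - 1) * ((n - 1) * lam - μ * (m + n - 1)) := by ring
    rw [e2, mul_eq_zero, or_iff_right hm1]
  · rw [← sub_eq_zero (a := R), hR]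
    have e2 : (n - 1) * lam - (m - 1) * μ - (n - 1) * lam = -(m - 1) * μ := by ring
    rw [e2, mul_eq_zero, or_iff_right (neg_ne_zero.2 hm1)]

/-- Where `f` and its differential do not vanish, the `T`-tensor vanishes if and only if the scalar
curvature takes one of two values. -/
theorem IsLocalQuasiEinstein.tensorT_eq_zero_iff (h : IsLocalQuasiEinstein S G f m lam R)
    (hn : 3 ≤ n) {y : EuclideanSpace ℝ (Fin n)} (hy : y ∈ S) (hf : f y ≠ 0)
    (hd : ∃ i, partialDeriv S f i y ≠ 0) :
    (∀ i j k, tensorT S G m lam f i j k y = 0) ↔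
      (R = n * ((n : ℝ) - 1) / (m + n - 1) * lam ∨ R = ((n : ℝ) - 1) * lam) := by
  obtain ⟨-, -, hid⟩ := h.identities
  obtain ⟨hs, htr, hg, hq⟩ := hid y hy
  have hn' : (3 : ℝ) ≤ n := by exact_mod_cast hn
  have hn1 : (n : ℝ) - 1 ≠ 0 := by linarith
  have hn2 : (n : ℝ) - 2 ≠ 0 := by linarith
  have hm1 : m - 1 ≠ 0 := by linarith [h.one_lt]
  have hmn : m + n - 2 ≠ 0 := by linarith [h.one_lt]
  set μ := ((n - 1) * lam - R) / (m - 1) with hμd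
  have hμ : (m - 1) * μ = (n - 1) * lam - R := by rw [hμd]; field_simp
  have hd0 : (fun i => partialDeriv S f i y) ≠ 0 := fun e => by
    obtain ⟨i, hi⟩ := hd
    exact hi (congrFun e i)
  -- Only here is f ≠ 0 needed: it frees the value of |Ric|² from the factor f.
  have hq' := mul_left_cancel₀ hf (hq.trans (mul_comm _ _))
  have hv : (ricciAt S G y).mulVec ((G y)⁻¹.mulVec fun i => partialDeriv S f i y)
      = μ • fun i => partialDeriv S f i y := by
    ext i
    refine mul_left_cancel₀ hm1 ?_
    have e := hg i
    rw [← hμ, ricciGrad] at e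
    simp only [mul_assoc, ← Finset.mul_sum] at e
    exact e
  have hu := umbilic_iff_trace_sq (ρ := (R - μ) / (n - 1)) (h.posDef y hy) hs hd0 hv
    (by rw [htr, Fintype.card_fin]; field_simp; ring)
  rw [hq', Fintype.card_fin, scalar_dichotomy hn h.one_lt hμ] at hu
  rw [← hu]
  refine forall_congr' fun i => forall_congr' fun j => forall_congr' fun k => ?_
  rw [h.tensorT_eq hn hy hμ, mul_eq_zero, or_iff_right (div_ne_zero hmn hn2)]

theorem tensorT_eq_zero_of_critical (hsc : ∀ y ∈ S, scalarCurv S G y = R)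
    {y : EuclideanSpace ℝ (Fin n)} (hy : y ∈ S) (hd : ∀ i, partialDeriv S f i y = 0)
    (i j k : Fin n) : tensorT S G m lam f i j k y = 0 := by
  have hds : ∀ i, partialDeriv S (scalarCurv S G) i y = 0 := fun i => by
    rw [partialDeriv_congr (F' := fun _ => R) hsc i hy, partialDeriv]
    simp
  simp [tensorT, ricciGrad, hd, hds]

end Local

/-! ### From the manifold to its charts. -/

section Charts

variable {n : ℕ} {H : Type*} [TopologicalSpace H]
  {I : ModelWithCorners ℝ (EuclideanSpace ℝ (Fin n)) H}
  {M : Type*} [TopologicalSpace M] [ChartedSpace H M] [IsManifold I ∞ M]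

theorem contDiffOn_funCoord {u : M → ℝ} (hu : ContMDiff I 𝓘(ℝ, ℝ) ∞ u) (x₀ : M) :
    ContDiffOn ℝ ∞ (funCoord I u x₀) (extChartAt I x₀).target :=
  contMDiffOn_iff_contDiffOn.1 (hu.comp_contMDiffOn (contMDiffOn_extChartAt_symm x₀))

/-- Identifies coordinate fields with constant sections of the tangent bundle trivialization, whose
smoothness then yields that of the metric components. -/
theorem coordVec_eq (x₀ : M) (i : Fin n) {y : EuclideanSpace ℝ (Fin n)}
    (hy : y ∈ (extChartAt I x₀).target) :
    coordVec I x₀ i y = (trivializationAt (EuclideanSpace ℝ (Fin n)) (TangentSpace I) x₀).symm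
      ((extChartAt I x₀).symm y) (stdVec i) := by
  have : IsManifold I 1 M := IsManifold.of_le (n := ∞) (by simp)
  have hs : (extChartAt I x₀).symm y ∈ (chartAt H x₀).source := by
    rw [← extChartAt_source I]; exact (extChartAt I x₀).map_target hy
  have h := TangentBundle.symmL_trivializationAt (𝕜 := ℝ) (I := I) hs
  rw [(extChartAt I x₀).right_inv hy] at h
  have hb : (extChartAt I x₀).symm y ∈
      (trivializationAt (EuclideanSpace ℝ (Fin n)) (TangentSpace I) x₀).baseSet := by simpa using hs
  have h' := (trivializationAt (EuclideanSpace ℝ (Fin n)) (TangentSpace I) x₀).symmL_apply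
    (R := ℝ) hb (stdVec i)
  rw [coordVec, ← h]
  exact h'

theorem contMDiffOn_coordVec (x₀ : M) (i : Fin n) :
    ContMDiffOn 𝓘(ℝ, EuclideanSpace ℝ (Fin n)) I.tangent ∞
      (fun y => (TotalSpace.mk' (EuclideanSpace ℝ (Fin n)) ((extChartAt I x₀).symm y)
        (coordVec I x₀ i y) : TangentBundle I M)) (extChartAt I x₀).target := by
  have hsrc : ∀ y ∈ (extChartAt I x₀).target, (extChartAt I x₀).symm y ∈
      (trivializationAt (EuclideanSpace ℝ (Fin n)) (TangentSpace I) x₀).baseSet := fun y hy => by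
    have := (extChartAt I x₀).map_target hy
    rw [extChartAt_source] at this
    simpa using this
  have hs := contMDiffOn_extChartAt_symm (I := I) (n := ∞) x₀
  have he := (trivializationAt (EuclideanSpace ℝ (Fin n)) (TangentSpace I) x₀).contMDiffOn_symm
    (IB := I) (n := ∞)
  have hp : ContMDiffOn 𝓘(ℝ, EuclideanSpace ℝ (Fin n))
      (I.prod 𝓘(ℝ, EuclideanSpace ℝ (Fin n))) ∞
      (fun y => ((extChartAt I x₀).symm y, (stdVec i : EuclideanSpace ℝ (Fin n))))
      (extChartAt I x₀).target := hs.prodMk contMDiffOn_const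
  refine (he.comp hp fun y hy => ?_).congr fun y hy => ?_
  · exact (trivializationAt (EuclideanSpace ℝ (Fin n)) (TangentSpace I) x₀).mem_target.2
      (hsrc y hy)
  · rw [coordVec_eq x₀ i hy]
    exact Trivialization.mk_symm _ (hsrc y hy) _

theorem contDiffOn_metricCoord (g : SmoothMetric I M) (x₀ : M) (i j : Fin n) :
    ContDiffOn ℝ ∞ (fun y => metricCoord g x₀ y i j) (extChartAt I x₀).target := by
  have hs := contMDiffOn_extChartAt_symm (I := I) (n := ∞) x₀
  have h := ContMDiffOn.clm_bundle_apply₂ (F₁ := EuclideanSpace ℝ (Fin n))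
    (F₂ := EuclideanSpace ℝ (Fin n)) (F₃ := ℝ) (E₃ := Bundle.Trivial M ℝ)
    (g.contMDiff.comp_contMDiffOn hs)
    (contMDiffOn_coordVec x₀ i) (contMDiffOn_coordVec x₀ j)
  intro y hy
  have h2 := (contMDiffWithinAt_totalSpace.1 (h y hy)).2
  exact contMDiffWithinAt_iff_contDiffWithinAt.1 (by simpa [metricCoord] using h2)

theorem posDef_metricCoord (g : SmoothMetric I M) (x₀ : M) {y : EuclideanSpace ℝ (Fin n)}
    (hy : y ∈ (extChartAt I x₀).target) : (metricCoord g x₀ y).PosDef := by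
  have : IsManifold I 1 M := IsManifold.of_le (n := ∞) (by simp)
  have hinj := (isInvertible_mfderivWithin_extChartAt_symm (I := I) (𝕜 := ℝ) hy).injective
  refine Matrix.PosDef.of_dotProduct_mulVec_pos ?_ fun v hv => ?_
  · ext i j
    exact (star_trivial _).trans (g.symm _ _ _)
  · set L := mfderivWithin 𝓘(ℝ, EuclideanSpace ℝ (Fin n)) I (extChartAt I x₀).symm (range I) y
    have hv' : (∑ i, v i • stdVec i : EuclideanSpace ℝ (Fin n)) ≠ 0 := fun h => hv <| by
      ext j
      simpa [stdVec, Pi.single_apply] using congrFun (congrArg WithLp.ofLp h) j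
    have hLs : L (∑ i, v i • stdVec i) = ∑ i, v i • coordVec I x₀ i y :=
      (map_sum L _ _).trans (Finset.sum_congr rfl fun i _ => map_smul L _ _)
    have hL : ∑ i, v i • coordVec I x₀ i y ≠ 0 := fun h =>
      hv' (hinj (hLs.trans (h.trans (map_zero L).symm)))
    have hpos := g.pos _ _ hL
    refine hpos.trans_eq ?_
    simp only [map_sum, map_smul, sum_apply, smul_apply,
      dotProduct, Matrix.mulVec, metricCoord, Matrix.of_apply, smul_eq_mul, Finset.mul_sum]
    rw [Finset.sum_comm]
    refine Finset.sum_congr rfl fun i _ => Finset.sum_congr rfl fun j _ => ?_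
    rw [Pi.star_apply, star_trivial]
    ring

theorem isLocalQuasiEinstein {g : SmoothMetric I M} {u : M → ℝ} {m lam R : ℝ} (hm : 1 < m)
    (hqE : IsQuasiEinstein g u m lam) (hR : HasConstantScalarCurv g R) (x₀ : M) :
    IsLocalQuasiEinstein (extChartAt I x₀).target (metricCoord g x₀) (funCoord I u x₀) m lam R where
  uniqueDiffOn := uniqueDiffOn_extChartAt_target x₀
  subset_closure := extChartAt_target_subset_closure_interior
  smooth_metric := contDiffOn_metricCoord g x₀
  posDef _ hy := posDef_metricCoord g x₀ hy
  smooth := contDiffOn_funCoord hqE.smooth x₀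
  one_lt := hm
  equation := hqE.equation x₀
  scalar := hR x₀

/-- Stated in the interior of the coordinate domain, so that u ≥ 0 suffices and this interior need
not be compared with the interior of M. -/
theorem partialDeriv_eq_zero_of_isLocalMin {S : Set (EuclideanSpace ℝ (Fin n))}
    {f : EuclideanSpace ℝ (Fin n) → ℝ} {y : EuclideanSpace ℝ (Fin n)} (hy : y ∈ interior S)
    (hf : ∀ z ∈ S, 0 ≤ f z) (h0 : f y = 0) (i : Fin n) : partialDeriv S f i y = 0 := by
  have hS : S ∈ nhds y := mem_interior_iff_mem_nhds.1 hy
  have hmin : IsLocalMin f y := by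
    filter_upwards [hS] with z hz
    rw [h0]; exact hf z hz
  rw [partialDeriv, fderivWithin_of_mem_nhds hS, hmin.fderiv_eq_zero]
  rfl

/-- A smooth function whose differential vanishes in the interior of every chart is constant. -/
theorem constant_of_partialDeriv_eq_zero [ConnectedSpace M] {u : M → ℝ}
    (hu : ContMDiff I 𝓘(ℝ, ℝ) ∞ u)
    (h : ∀ x₀ : M, ∀ y ∈ interior (extChartAt I x₀).target, ∀ i,
      partialDeriv (extChartAt I x₀).target (funCoord I u x₀) i y = 0) :
    ∃ c : ℝ, ∀ x, u x = c := by
  have hloc : IsLocallyConstant u := by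
    rw [IsLocallyConstant.iff_eventually_eq]
    intro x₀
    set S := (extChartAt I x₀).target with hSdef
    set F := funCoord I u x₀
    have hF := contDiffOn_funCoord hu x₀
    have hSu : UniqueDiffOn ℝ S := uniqueDiffOn_extChartAt_target x₀
    -- The differential is continuous up to the boundary and vanishes on the dense interior.
    have hz : ∀ y ∈ S, fderivWithin ℝ F S y = 0 := by
      have hcl : EqOn (fderivWithin ℝ F S) 0 S := by
        refine EqOn.of_subset_closure (s := interior S) ?_
          (hF.continuousOn_fderivWithin hSu (by simp)) continuousOn_const interior_subset
          extChartAt_target_subset_closure_interior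
        intro y hy
        refine ContinuousLinearMap.coe_injective
          ((EuclideanSpace.basisFun (Fin n) ℝ).toBasis.ext fun i => ?_)
        have e := h x₀ y hy i
        rw [partialDeriv, stdVec] at e
        change fderivWithin ℝ F S y ((EuclideanSpace.basisFun (Fin n) ℝ).toBasis i) = 0
        rw [OrthonormalBasis.coe_toBasis, EuclideanSpace.basisFun_apply]
        exact e
      exact hcl
    obtain ⟨ε, hε, hball⟩ := Metric.mem_nhdsWithin_iff.1 (extChartAt_target_mem_nhdsWithin (I := I) x₀)
    -- A convex neighbourhood within the range of the model, on which the mean value inequality with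
    -- constant 0 applies even around a boundary point.
    set V := Metric.ball (extChartAt I x₀ x₀) ε ∩ range I with hV
    have hVc : Convex ℝ V := (convex_ball _ _).inter I.convex_range
    have hVS : ∀ y ∈ V, HasFDerivWithinAt F (0 : EuclideanSpace ℝ (Fin n) →L[ℝ] ℝ) V y := by
      intro y hy
      have h1 := ((hF.differentiableOn (by simp)) y (hball hy)).hasFDerivWithinAt
      rw [hz y (hball hy)] at h1
      exact h1.mono hball
    have hx0 : extChartAt I x₀ x₀ ∈ V := ⟨Metric.mem_ball_self hε, by simp⟩
    have hmem : ∀ᶠ x in nhds x₀, x ∈ (extChartAt I x₀).source ∧ extChartAt I x₀ x ∈ V := by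
      filter_upwards [extChartAt_source_mem_nhds (I := I) x₀,
        (continuousAt_extChartAt (I := I) x₀).preimage_mem_nhds (Metric.ball_mem_nhds _ hε)]
        with x hx hx'
      exact ⟨hx, hx', extChartAt_target_subset_range x₀ ((extChartAt I x₀).map_source hx)⟩
    filter_upwards [hmem] with x hx
    have hc : F (extChartAt I x₀ x) = F (extChartAt I x₀ x₀) := by
      have hle := hVc.norm_image_sub_le_of_norm_hasFDerivWithin_le (C := 0) hVS (by simp) hx0 hx.2
      rw [zero_mul, norm_le_zero_iff, sub_eq_zero] at hle
      exact hle
    rwa [show F = funCoord I u x₀ from rfl, funCoord, funCoord, (extChartAt I x₀).left_inv hx.1,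
      extChartAt_to_inv] at hc
  obtain ⟨x₁⟩ := (inferInstance : Nonempty M)
  exact ⟨u x₁, fun x => hloc.apply_eq_of_preconnectedSpace x x₁⟩

end Charts

end QuasiEinstein

end

/-! ### The global equivalence. -/

theorem mainTheorem5 (n : ℕ) (hn : 3 ≤ n)
    {H : Type*} [TopologicalSpace H] (I : ModelWithCorners ℝ (EuclideanSpace ℝ (Fin n)) H)
    {M : Type*} [TopologicalSpace M] [ChartedSpace H M] [IsManifold I ∞ M] [ConnectedSpace M]
    (g : QuasiEinstein.SmoothMetric I M) (u : M → ℝ) (m lam R : ℝ) (hm : 1 < m)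
    (hqE : QuasiEinstein.IsQuasiEinstein g u m lam)
    (hnontrivial : ¬ ∃ c : ℝ, ∀ x : M, u x = c)
    (hR : QuasiEinstein.HasConstantScalarCurv g R) :
    QuasiEinstein.TFlat g u m lam ↔
      (R = n * ((n : ℝ) - 1) / (m + n - 1) * lam ∨ R = ((n : ℝ) - 1) * lam) := by
  have hloc := QuasiEinstein.isLocalQuasiEinstein hm hqE hR
  have hnonneg : ∀ x, 0 ≤ u x := fun x => by
    rcases (Set.ext_iff.1 (I.interior_union_boundary_eq_univ (M := M)) x).2 trivial with hx | hx
    · exact (hqE.pos_interior x hx).le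
    · exact (hqE.zero_boundary x hx).ge
  have hne : ∀ x₀ : M, ∀ y ∈ interior (extChartAt I x₀).target,
      (∃ i, QuasiEinstein.partialDeriv (extChartAt I x₀).target
        (QuasiEinstein.funCoord I u x₀) i y ≠ 0) → QuasiEinstein.funCoord I u x₀ y ≠ 0 := by
    rintro x₀ y hy ⟨i, hi⟩ h0
    exact hi (QuasiEinstein.partialDeriv_eq_zero_of_isLocalMin hy (fun z _ => hnonneg _) h0 i)
  constructor
  · intro hT
    -- If R had neither value, the vanishing of T would force du = 0 in the interior of every chart
    -- domain, hence u constant.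
    by_contra hcon
    refine hnontrivial (QuasiEinstein.constant_of_partialDeriv_eq_zero hqE.smooth ?_)
    intro x₀ y hy i
    by_contra hi
    exact hcon (((hloc x₀).tensorT_eq_zero_iff hn (interior_subset hy) (hne x₀ y hy ⟨i, hi⟩)
      ⟨i, hi⟩).1 (hT x₀ y (interior_subset hy)))
  · intro hRv x₀ y hy i j k
    -- By continuity of T it suffices to treat interior points of the chart domain, where u ≠ 0
    -- whenever du ≠ 0; on the boundary u may vanish without du doing so.
    refine Set.EqOn.of_subset_closure (s := interior (extChartAt I x₀).target) (g := 0) ?_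
      ((hloc x₀).continuousOn_tensorT i j k) continuousOn_const interior_subset
      extChartAt_target_subset_closure_interior hy
    intro z hz
    by_cases hd : ∃ i, QuasiEinstein.partialDeriv (extChartAt I x₀).target
        (QuasiEinstein.funCoord I u x₀) i z ≠ 0
    · exact ((hloc x₀).tensorT_eq_zero_iff hn (interior_subset hz) (hne x₀ z hz hd) hd).2 hRv i j k
    · push Not at hd
      exact QuasiEinstein.tensorT_eq_zero_of_critical (hR x₀) (interior_subset hz) hd i j k
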